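/- Let $IR(3,\mathbb F_2)$ be the set of all subsets $E\subseteq\mathbb F_2^3\setminus\{0\}$ such that the matroid of $\mathbb F_2$-linear independence on $E$ is a regular matroid of rank $3$, partially ordered by inclusion. The group $G=SL(3,\mathbb F_2)$ acts on this poset by $g\cdot E=\{gv : v\in E\}$, and hence acts linearly on the homology $H_3(IR(3,\mathbb F_2);\mathbb C)$ of the poset, i.e. the simplicial homology of its nerve (equivalently, of the simplicial complex whose $k$-simplices are the chains $x_0<\dots<x_k$ of the poset). Here a matroid is regular if it is represented by the columns of a totally unimodular real matrix. Theorem. $H_3(IR(3,\mathbb F_2);\mathbb C)$ is the unique $8$-dimensional irreducible complex representation of $SL(3,\mathbb F_2)$: it is irreducible, it has dimension $8$, and every irreducible complex representation of $SL(3,\mathbb F_2)$ of dimension $8$ is isomorphic to it. -/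

import Mathlib

namespace RegularMatroid

/-- A matroid `M` (on a finite ground set) is regular if it is represented by the columns of a
totally unimodular real matrix: the columns of `A` are indexed by the elements of `M`, and a set of
elements is independent in `M` exactly when the corresponding columns are linearly independent. -/
def IsRegular {α : Type*} (M : Matroid α) : Prop :=
  ∃ (n : ℕ) (A : Matrix (Fin n) α ℝ),
    (A.submatrix id (Subtype.val : M.E → α)).IsTotallyUnimodular ∧
      ∀ I : Set α, I ⊆ M.E → (M.Indep I ↔ LinearIndepOn ℝ A.col I)

theorem linearIndepOn_augment {r : ℕ} {I J : Set (Fin r → ZMod 2)}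
    (hI : LinearIndepOn (ZMod 2) id I) (hJ : LinearIndepOn (ZMod 2) id J)
    (h : I.ncard < J.ncard) : ∃ e ∈ J, e ∉ I ∧ LinearIndepOn (ZMod 2) id (insert e I) := by
  classical
  by_contra! hcon
  have hsub : J ⊆ Submodule.span (ZMod 2) I := by
    intro e he
    by_contra hn
    exact hcon e he (fun hm => hn (Submodule.subset_span hm)) (hI.id_insert hn)
  have h1 : Module.finrank (ZMod 2) (Submodule.span (ZMod 2) I) = I.ncard := by
    have := finrank_span_set_eq_card (R := ZMod 2) (s := I) hI
    rw [this, ← Set.ncard_eq_toFinset_card']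
  have h2 : Module.finrank (ZMod 2) (Submodule.span (ZMod 2) J) = J.ncard := by
    have := finrank_span_set_eq_card (R := ZMod 2) (s := J) hJ
    rw [this, ← Set.ncard_eq_toFinset_card']
  have h3 := Submodule.finrank_mono (Submodule.span_le.2 hsub)
  omega

/-- The matroid of linear independence over `𝔽₂` on a set `E` of vectors in `𝔽₂ʳ`. -/
def binaryMatroid {r : ℕ} (E : Set (Fin r → ZMod 2)) : Matroid (Fin r → ZMod 2) :=
  (IndepMatroid.ofFinite E.toFinite (fun I => I ⊆ E ∧ LinearIndepOn (ZMod 2) id I)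
    ⟨Set.empty_subset _, linearIndepOn_empty _ _⟩
    (fun _ _ hJ hIJ => ⟨hIJ.trans hJ.1, hJ.2.mono hIJ⟩)
    (fun _ _ hI hJ h => by
      obtain ⟨e, heJ, heI, he⟩ := linearIndepOn_augment hI.2 hJ.2 h
      exact ⟨e, heJ, heI, Set.insert_subset (hJ.1 heJ) hI.1, he⟩)
    (fun _ hI => hI.1)).matroid

@[simp] theorem binaryMatroid_ground {r : ℕ} (E : Set (Fin r → ZMod 2)) :
    (binaryMatroid E).E = E := rfl

@[simp] theorem binaryMatroid_indep_iff {r : ℕ} (E I : Set (Fin r → ZMod 2)) :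
    (binaryMatroid E).Indep I ↔ I ⊆ E ∧ LinearIndepOn (ZMod 2) id I := Iff.rfl

/-- The poset `IR(r, 𝔽₂)` of all subsets of `𝔽₂ʳ ∖ {0}` which are regular matroids of rank `r`,
ordered by inclusion. -/
abbrev IR (r : ℕ) : Type :=
  {E : Set (Fin r → ZMod 2) //
    (0 : Fin r → ZMod 2) ∉ E ∧ IsRegular (binaryMatroid E) ∧ (binaryMatroid E).eRank = r}

theorem IsRegular.map {α : Type*} {M : Matroid α} (hM : IsRegular M) (e : α ≃ α) :
    IsRegular (M.map e e.injective.injOn) := by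
  obtain ⟨n, A, hA, hind⟩ := hM
  refine ⟨n, A.submatrix id e.symm, ?_, ?_⟩
  · have hmem : ∀ x : (M.map e e.injective.injOn).E, e.symm x.1 ∈ M.E := by
      rintro ⟨_, y, hy, rfl⟩
      simpa using hy
    exact hA.submatrix (id : Fin n → Fin n)
      (fun x : (M.map e e.injective.injOn).E => (⟨e.symm x.1, hmem x⟩ : M.E))
  · rintro I hI
    obtain ⟨I, rfl⟩ : ∃ I₀, I = e '' I₀ := ⟨e.symm '' I, by simp [Set.image_image]⟩
    have hI' : I ⊆ M.E := (Set.image_subset_image_iff e.injective).1 hI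
    rw [Matroid.map_image_indep_iff hI', hind I hI', LinearIndepOn, LinearIndepOn,
      ← linearIndependent_equiv (e.image I)]
    have hcol : (fun x : ↥(e '' I) => (A.submatrix id e.symm).col x) ∘ ⇑(e.image I) =
        fun x : I => A.col x := by
      funext x
      funext i
      simp [Matrix.col]
    rw [hcol]

theorem binaryMatroid_image {r : ℕ} (E : Set (Fin r → ZMod 2))
    (f : (Fin r → ZMod 2) ≃ₗ[ZMod 2] (Fin r → ZMod 2)) :
    binaryMatroid (f '' E) = (binaryMatroid E).map f.toEquiv f.toEquiv.injective.injOn := by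
  refine Matroid.ext_indep rfl fun I hI => ?_
  obtain ⟨I, rfl⟩ : ∃ I₀, I = f '' I₀ := ⟨f.symm '' I, by simp [Set.image_image]⟩
  have hI' : I ⊆ E := (Set.image_subset_image_iff f.injective).1 hI
  have h1 : ((binaryMatroid E).map f.toEquiv f.toEquiv.injective.injOn).Indep (f '' I) ↔
      (binaryMatroid E).Indep I := Matroid.map_image_indep_iff (M := binaryMatroid E) hI'
  rw [h1, binaryMatroid_indep_iff, binaryMatroid_indep_iff]
  refine and_congr ⟨fun _ => hI', fun _ => hI⟩ ?_
  rw [LinearIndepOn, LinearIndepOn, ← linearIndependent_equiv (f.toEquiv.image I)]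
  exact f.toLinearMap.linearIndependent_iff (v := fun x : I => (x : Fin r → ZMod 2))
    (LinearMap.ker_eq_bot.2 f.injective)

/-- `SL(r, 𝔽₂)` acts on `IR(r, 𝔽₂)` by `g • E = {g v | v ∈ E}`. -/
noncomputable instance (r : ℕ) :
    MulAction (Matrix.SpecialLinearGroup (Fin r) (ZMod 2)) (IR r) where
  smul g E := ⟨Matrix.SpecialLinearGroup.toLin' g '' E.1, by
    obtain ⟨E, h0, hreg, hrk⟩ := E
    refine ⟨?_, ?_, ?_⟩
    · rintro ⟨x, hx, h⟩
      exact h0 (by rwa [(LinearEquiv.map_eq_zero_iff _).1 h] at hx)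
    · rw [binaryMatroid_image]
      exact hreg.map _
    · rw [binaryMatroid_image, Matroid.eRank_map]
      exact hrk⟩
  one_smul E := Subtype.ext <| by
    change Matrix.SpecialLinearGroup.toLin' 1 '' E.1 = E.1
    simp
  mul_smul g h E := Subtype.ext <| by
    change Matrix.SpecialLinearGroup.toLin' (g * h) '' E.1 =
      Matrix.SpecialLinearGroup.toLin' g '' (Matrix.SpecialLinearGroup.toLin' h '' E.1)
    rw [map_mul, Set.image_image]
    rfl

theorem coe_smul {r : ℕ} (g : Matrix.SpecialLinearGroup (Fin r) (ZMod 2)) (E : IR r) :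
    ((g • E : IR r) : Set (Fin r → ZMod 2)) = (fun v => (g : Matrix _ _ _).mulVec v) '' E.1 := rfl

theorem smul_mono {r : ℕ} (g : Matrix.SpecialLinearGroup (Fin r) (ZMod 2)) :
    Monotone (fun E : IR r => g • E) :=
  fun _ _ h => Set.image_mono h

open CategoryTheory in
/-- The homology `Hₙ(IR(r, 𝔽₂); ℂ)`: the simplicial homology of the nerve of the poset, whose
nondegenerate `k`-simplices are the chains `x₀ < ⋯ < xₖ`. -/
noncomputable abbrev homologyIR (r n : ℕ) : ModuleCat.{0} ℂ :=
  (nerve (IR r)).homology (ModuleCat.of ℂ ℂ) n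

open CategoryTheory in
/-- The representation of `SL(r, 𝔽₂)` on `Hₙ(IR(r, 𝔽₂); ℂ)`: the element `g` acts by the map
induced by the automorphism `E ↦ g • E` of the poset. -/
noncomputable def homologyRep (r n : ℕ) :
    Representation ℂ (Matrix.SpecialLinearGroup (Fin r) (ZMod 2)) (homologyIR r n) where
  toFun g := (SSet.homologyMap (nerveMap (smul_mono (r := r) g).functor)
    (ModuleCat.of ℂ ℂ) n).hom
  map_one' := by
    have h : nerveMap (smul_mono (r := r) 1).functor = 𝟙 (nerve (IR r)) := by
      have hF : (smul_mono (r := r) 1).functor = 𝟭 (IR r) :=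
        CategoryTheory.Functor.ext (fun E => one_smul _ E) (fun _ _ _ => Subsingleton.elim _ _)
      rw [hF]; rfl
    rw [h, SSet.homologyMap_id]
    rfl
  map_mul' g g' := by
    have h : nerveMap (smul_mono (r := r) (g * g')).functor =
        nerveMap (smul_mono (r := r) g').functor ≫ nerveMap (smul_mono (r := r) g).functor := by
      have hF : (smul_mono (r := r) (g * g')).functor =
          (smul_mono (r := r) g').functor ⋙ (smul_mono (r := r) g).functor :=
        CategoryTheory.Functor.ext (fun E => mul_smul _ _ E) (fun _ _ _ => Subsingleton.elim _ _)
      rw [hF]; rfl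
    rw [h, SSet.homologyMap_comp]
    rfl

end RegularMatroid

/-! Taking complements in the seven points of the Fano plane reverses the order and identifies `IR
3` with the nonempty point sets containing no complement of a line (`comp_mem_iff`). Indeed the
plane minus a point is the graphic matroid M(K₄), the whole plane has no real representation, and
the rank drops below 3 exactly when the remaining points lie on a line. These sets are the faces of
a 3-dimensional simplicial complex on seven vertices with 28 tetrahedra, the complements of bases,
and the nerve of `IR 3` is its barycentric subdivision. There is nothing in degree 4, so H₃ is the
space of 3-cycles: alternating functions on quadruples that vanish on line complements and sum to
zero over the last entry (`tupleEquiv`).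

Label the points by ℤ/7 along a Singer cycle. Its normalizer N is the group of maps x ↦ 2ᵏx + m, of
order 21 and index 8. Elimination shows that eight values determine a cycle
(`eq_zero_of_coordTuple`). For a primitive cube root of unity ω, Pfaffians of circulant forms
combine to a cycle fixed by the Singer cycle and multiplied by ω under x ↦ 2x. An explicit matrix
inverse over ℤ[ω] shows that its translates by the eight coset representatives form a basis
(`sum_inverse_mul_eigenTuple`). So H₃ is induced from a character of N. Moreover this eigenspace is
a line (`mem_span_eigenClass`); splitting H₃ into two complementary subrepresentations therefore
puts the generating eigenvector into one of them, which proves irreducibility.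

For uniqueness, let V be irreducible of dimension 8. If the Singer cycle fixed no nonzero vector,
the element of order 3 and its square would have trace zero, and the fixed space of that element
would have dimension 8/3 (`exists_singer_fixed`). Hence N has an eigenvector fixed by the Singer
cycle, with some eigenvalue ζ of order dividing 3, and its eight translates are a basis. If ζ were
1, the group would permute that basis and leave a nonzero vector invariant. So ζ is a primitive cube
root of unity, and V is induced from the same kind of character (`nonempty_equiv_of_eigenvectors`).
-/

section NormalizedChains

/-! ### Normalized chains in coordinates, and homology in top degree. -/

open CategoryTheory Simplicial HomologicalComplex Limits

/-- An element viewed as a morphism out of ℂ: this lets the universal property `liftCycles` be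
applied to a single chain. -/
lemma ModuleCat.exists_hom_apply_one (M : ModuleCat.{0} ℂ) (w : M) :
    ∃ k : ModuleCat.of ℂ ℂ ⟶ M, k.hom (1 : ℂ) = w ∧
      ∀ (N : ModuleCat.{0} ℂ) (f : M ⟶ N), f.hom w = 0 → k ≫ f = 0 := by
  refine ⟨ModuleCat.ofHom (LinearMap.toSpanSingleton ℂ M w), by simp, fun N f hf => ?_⟩
  ext
  simpa using hf

namespace SSet

variable (S : SSet.{0}) {n : ℕ}

/-- The coefficient of a normalized chain at a simplex (zero at degenerate simplices). -/
noncomputable def normalizedCoeff (x : S _⦋n⦌) :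
    (S.normalizedChainComplex (ModuleCat.of ℂ ℂ)).X n ⟶ ModuleCat.of ℂ ℂ := by
  classical
  exact Cofan.IsColimit.desc (S.isColimitCofanNormalizedChainComplex (ModuleCat.of ℂ ℂ) n)
    (fun y => if y.1 = x then 𝟙 _ else 0)

open Classical in
lemma ι_normalizedCoeff (x y : S _⦋n⦌) (hy : y ∈ S.nonDegenerate n) :
    S.ιNormalizedChainComplex y ≫ S.normalizedCoeff x = if y = x then 𝟙 _ else 0 :=
  Cofan.IsColimit.fac (S.isColimitCofanNormalizedChainComplex (ModuleCat.of ℂ ℂ) n) _ ⟨y, hy⟩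

lemma sum_normalizedCoeff [Fintype (S _⦋n⦌)] :
    ∑ x : S _⦋n⦌, S.normalizedCoeff x ≫ S.ιNormalizedChainComplex x = 𝟙 _ := by
  classical
  refine normalizedChainComplex_hom_ext _ fun y hy => ?_
  rw [Preadditive.comp_sum, Finset.sum_eq_single y]
  · rw [← Category.assoc, ι_normalizedCoeff _ _ _ hy, if_pos rfl]; simp
  · intro x _ hx
    rw [← Category.assoc, ι_normalizedCoeff _ _ _ hy, if_neg (Ne.symm hx), zero_comp]
  · simp

lemma normalizedCoeff_of_degenerate {x : S _⦋n⦌} (hx : x ∈ S.degenerate n) :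
    S.normalizedCoeff x = 0 := by
  classical
  refine normalizedChainComplex_hom_ext _ fun y hy => ?_
  rw [ι_normalizedCoeff _ _ _ hy, if_neg, comp_zero]
  rintro rfl
  exact hy hx

/-- The coefficient functionals determine a normalized chain. -/
lemma normalizedChain_ext [Fintype (S _⦋n⦌)]
    {z w : (S.normalizedChainComplex (ModuleCat.of ℂ ℂ)).X n}
    (h : ∀ x ∈ S.nonDegenerate n, (S.normalizedCoeff x).hom z = (S.normalizedCoeff x).hom w) :
    z = w := by
  have key : ∀ z : (S.normalizedChainComplex (ModuleCat.of ℂ ℂ)).X n,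
      z = ∑ x : S _⦋n⦌, (S.ιNormalizedChainComplex (R := ModuleCat.of ℂ ℂ) x).hom ((S.normalizedCoeff x).hom z) := by
    intro z
    have := congr($(S.sum_normalizedCoeff (n := n)).hom z)
    simpa [ModuleCat.hom_sum, LinearMap.sum_apply] using this.symm
  rw [key z, key w]
  refine Finset.sum_congr rfl fun x _ => ?_
  by_cases hx : x ∈ S.nonDegenerate n
  · rw [h x hx]
  · rw [normalizedCoeff_of_degenerate _ (by simpa [SSet.nonDegenerate] using hx)]
    rfl

/-- The normalized chain with given coefficients. -/
noncomputable def normalizedChainOf [Fintype (S _⦋n⦌)] (f : S _⦋n⦌ → ℂ) :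
    (S.normalizedChainComplex (ModuleCat.of ℂ ℂ)).X n :=
  ∑ x : S _⦋n⦌, (S.ιNormalizedChainComplex (R := ModuleCat.of ℂ ℂ) x).hom (f x)

lemma normalizedCoeff_chainOf [Fintype (S _⦋n⦌)] (f : S _⦋n⦌ → ℂ) {x : S _⦋n⦌}
    (hx : x ∈ S.nonDegenerate n) :
    (S.normalizedCoeff x).hom (S.normalizedChainOf f) = f x := by
  classical
  rw [normalizedChainOf, map_sum, Finset.sum_eq_single x]
  · have := congr($(S.ι_normalizedCoeff x x hx).hom (f x))
    simpa using this
  · intro y _ hyx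
    by_cases hy : y ∈ S.nonDegenerate n
    · have := congr($(S.ι_normalizedCoeff x y hy).hom (f y))
      simpa [hyx] using this
    · rw [ιNormalizedChainComplex_eq_zero _ _ (by simpa [SSet.nonDegenerate] using hy)]
      simp
  · simp

-- Inserting the resolution of the identity `sum_normalizedCoeff` before the differential reduces
-- the claim to one simplex. Degenerate faces vanish in the normalized complex and cannot equal the
-- nondegenerate `t`.
open Classical in
lemma normalizedCoeff_d [Fintype (S _⦋n + 1⦌)]
    (z : (S.normalizedChainComplex (ModuleCat.of ℂ ℂ)).X (n + 1))
    (t : S _⦋n⦌) (ht : t ∈ S.nonDegenerate n) :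
    (S.normalizedCoeff t).hom (((S.normalizedChainComplex (ModuleCat.of ℂ ℂ)).d (n + 1) n).hom z) =
      ∑ x : S _⦋n + 1⦌, (S.normalizedCoeff x).hom z *
        ∑ i : Fin (n + 2), if S.δ i x = t then (-1 : ℂ) ^ (i : ℕ) else 0 := by
  have h1 := congr($(S.sum_normalizedCoeff (n := n + 1)) ≫
    (S.normalizedChainComplex (ModuleCat.of ℂ ℂ)).d (n + 1) n ≫ S.normalizedCoeff t)
  rw [Category.id_comp, Preadditive.sum_comp] at h1
  simp only [Category.assoc] at h1
  have h2 := congr($(h1).hom z)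
  rw [ModuleCat.hom_sum, LinearMap.sum_apply] at h2
  simp only [ModuleCat.hom_comp, LinearMap.comp_apply] at h2
  rw [← h2]
  refine Finset.sum_congr rfl fun x _ => ?_
  have h3 := congr($(S.ιNormalizedChainComplex_d (R := ModuleCat.of ℂ ℂ) x) ≫ S.normalizedCoeff t)
  rw [Preadditive.sum_comp] at h3
  have h4 := congr($(h3).hom ((S.normalizedCoeff x).hom z))
  rw [ModuleCat.hom_sum, LinearMap.sum_apply] at h4
  simp only [Category.assoc, ModuleCat.hom_comp, LinearMap.comp_apply] at h4
  rw [h4, Finset.mul_sum]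
  refine Finset.sum_congr rfl fun i _ => ?_
  rw [show (ModuleCat.Hom.hom ((-1 : ℤ) ^ (i : ℕ) •
      S.ιNormalizedChainComplex (R := ModuleCat.of ℂ ℂ) (S.δ i x)))
      ((S.normalizedCoeff x).hom z) = (-1 : ℤ) ^ (i : ℕ) •
      (S.ιNormalizedChainComplex (R := ModuleCat.of ℂ ℂ) (S.δ i x)).hom
        ((S.normalizedCoeff x).hom z) from rfl, map_zsmul]
  by_cases hd : S.δ i x ∈ S.nonDegenerate n
  · have h5 := congr($(S.ι_normalizedCoeff t _ hd).hom ((S.normalizedCoeff x).hom z))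
    rw [ModuleCat.hom_comp, LinearMap.comp_apply] at h5
    rw [h5]
    split_ifs
    · simp [mul_comm]
    · simp
  · rw [ιNormalizedChainComplex_eq_zero _ _ (by simpa [SSet.nonDegenerate] using hd), if_neg]
    · simp
    · rintro rfl; exact hd ht

lemma normalizedCoeff_map {S T : SSet.{0}} (φ : S ⟶ T) [Fintype (S _⦋n⦌)]
    (hφ : Function.Injective (φ.app (.op ⦋n⦌)))
    (z : (S.normalizedChainComplex (ModuleCat.of ℂ ℂ)).X n) (x : S _⦋n⦌)
    (hx : φ.app _ x ∈ T.nonDegenerate n) :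
    (T.normalizedCoeff (φ.app _ x)).hom (((normalizedChainComplexMap φ (ModuleCat.of ℂ ℂ)).f n).hom z) =
      (S.normalizedCoeff x).hom z := by
  classical
  suffices h : (normalizedChainComplexMap φ (ModuleCat.of ℂ ℂ)).f n ≫ T.normalizedCoeff (φ.app _ x) =
      S.normalizedCoeff x from congr($(h).hom z)
  refine normalizedChainComplex_hom_ext _ fun y hy => ?_
  rw [ι_normalizedChainComplexMap_f_assoc, ι_normalizedCoeff _ _ _ hy]
  by_cases hd : φ.app _ y ∈ T.nonDegenerate n
  · rw [ι_normalizedCoeff _ _ _ hd]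
    simp [hφ.eq_iff]
  · rw [ιNormalizedChainComplex_eq_zero _ _ (by simpa [SSet.nonDegenerate] using hd), if_neg,
      zero_comp]
    rintro rfl; exact hd hx

section TopDegree

variable (hS : S.nonDegenerate (n + 1) = ∅)
include hS

lemma normalizedChainComplex_d_eq_zero (R : ModuleCat.{0} ℂ) :
    (S.normalizedChainComplex R).d (n + 1) n = 0 := by
  refine normalizedChainComplex_hom_ext _ fun x hx => ?_
  simp [hS] at hx

lemma isIso_homologyπ_normalizedChainComplex (R : ModuleCat.{0} ℂ) :
    IsIso ((S.normalizedChainComplex R).homologyπ n) :=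
  HomologicalComplex.isIso_homologyπ _ (n + 1) n (by simp)
    (S.normalizedChainComplex_d_eq_zero hS R)

/-- If there is no nondegenerate `n + 1`-simplex, a homology class of degree `n` has a unique
normalized representative. -/
noncomputable def homologyToNormalized :
    S.homology (ModuleCat.of ℂ ℂ) n ⟶ (S.normalizedChainComplex (ModuleCat.of ℂ ℂ)).X n :=
  haveI := S.isIso_homologyπ_normalizedChainComplex hS (ModuleCat.of ℂ ℂ)
  HomologicalComplex.homologyMap (S.toNormalizedChainComplex _) n ≫
    inv ((S.normalizedChainComplex (ModuleCat.of ℂ ℂ)).homologyπ n) ≫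
    (S.normalizedChainComplex (ModuleCat.of ℂ ℂ)).iCycles n

lemma homologyToNormalized_injective :
    Function.Injective (S.homologyToNormalized hS).hom := by
  have := S.isIso_homologyπ_normalizedChainComplex hS (ModuleCat.of ℂ ℂ)
  have : Mono (S.homologyToNormalized hS) := by
    unfold homologyToNormalized
    infer_instance
  exact (ModuleCat.mono_iff_injective _).1 this

lemma d_homologyToNormalized (m : ℕ) (z : (S.homology (ModuleCat.of ℂ ℂ) n : ModuleCat.{0} ℂ)) :
    ((S.normalizedChainComplex (ModuleCat.of ℂ ℂ)).d n m).hom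
      ((S.homologyToNormalized hS).hom z) = 0 := by
  have h : S.homologyToNormalized hS ≫
      (S.normalizedChainComplex (ModuleCat.of ℂ ℂ)).d n m = 0 := by
    simp [homologyToNormalized]
  exact congr($(h).hom z)

lemma exists_homologyToNormalized_eq (m : ℕ) (hm : m + 1 = n)
    (w : (S.normalizedChainComplex (ModuleCat.of ℂ ℂ)).X n)
    (hw : ((S.normalizedChainComplex (ModuleCat.of ℂ ℂ)).d n m).hom w = 0) :
    ∃ z, (S.homologyToNormalized hS).hom z = w := by
  have := S.isIso_homologyπ_normalizedChainComplex hS (ModuleCat.of ℂ ℂ)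
  obtain ⟨k, hk1, hk0⟩ := ModuleCat.exists_hom_apply_one _ w
  have hk := hk0 _ _ hw
  let l := HomologicalComplex.liftCycles _ k m (by subst hm; simp) hk
  let p : ModuleCat.of ℂ ℂ ⟶ S.homology (ModuleCat.of ℂ ℂ) n :=
    l ≫ (S.normalizedChainComplex (ModuleCat.of ℂ ℂ)).homologyπ n ≫
      inv (HomologicalComplex.homologyMap (S.toNormalizedChainComplex (ModuleCat.of ℂ ℂ)) n)
  have hp : p ≫ S.homologyToNormalized hS = k := by
    simp [p, l, homologyToNormalized]
  refine ⟨p.hom (1 : ℂ), ?_⟩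
  rw [← hk1, ← hp]
  rfl

lemma homologyToNormalized_map {T : SSet.{0}} (hT : T.nonDegenerate (n + 1) = ∅) (φ : S ⟶ T)
    (z : (S.homology (ModuleCat.of ℂ ℂ) n : ModuleCat.{0} ℂ)) :
    (T.homologyToNormalized hT).hom ((SSet.homologyMap φ (ModuleCat.of ℂ ℂ) n).hom z) =
      ((normalizedChainComplexMap φ (ModuleCat.of ℂ ℂ)).f n).hom ((S.homologyToNormalized hS).hom z) := by
  have := S.isIso_homologyπ_normalizedChainComplex hS (ModuleCat.of ℂ ℂ)
  have := T.isIso_homologyπ_normalizedChainComplex hT (ModuleCat.of ℂ ℂ)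
  suffices h : SSet.homologyMap φ (ModuleCat.of ℂ ℂ) n ≫ T.homologyToNormalized hT =
      S.homologyToNormalized hS ≫ (normalizedChainComplexMap φ (ModuleCat.of ℂ ℂ)).f n from congr($(h).hom z)
  have h1 : SSet.homologyMap φ (ModuleCat.of ℂ ℂ) n ≫
      HomologicalComplex.homologyMap (T.toNormalizedChainComplex (ModuleCat.of ℂ ℂ)) n =
      HomologicalComplex.homologyMap (S.toNormalizedChainComplex (ModuleCat.of ℂ ℂ)) n ≫
      HomologicalComplex.homologyMap (normalizedChainComplexMap φ (ModuleCat.of ℂ ℂ)) n := by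
    rw [← HomologicalComplex.homologyMap_comp, ← HomologicalComplex.homologyMap_comp,
      toNormalizedChainComplex_normalizedChainComplexMap]
  unfold homologyToNormalized
  rw [reassoc_of% h1]
  simp only [Category.assoc]
  congr 1
  rw [← HomologicalComplex.cyclesMap_i, ← Category.assoc, ← Category.assoc]
  congr 1
  rw [IsIso.comp_inv_eq, Category.assoc, ← HomologicalComplex.homologyπ_naturality]
  simp

end TopDegree

end SSet

/-! ### Top homology of the nerve of a finite poset as cycles on strict chains. -/

namespace PosetHomology

variable {X : Type} [PartialOrder X] {n : ℕ}

/-- The simplex of the nerve attached to a strict chain. -/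
def simplexOfChain (x : Fin (n + 1) ↪o X) : (nerve X) _⦋n⦌ :=
  x.monotone.functor

lemma simplex_ext {s t : (nerve X) _⦋n⦌}
    (h : ∀ i, (s : ComposableArrows X n).obj i = (t : ComposableArrows X n).obj i) : s = t :=
  CategoryTheory.Functor.ext h (fun _ _ _ => Subsingleton.elim _ _)

lemma simplexOfChain_injective :
    Function.Injective (simplexOfChain : (Fin (n + 1) ↪o X) → (nerve X) _⦋n⦌) :=
  fun _ _ h => RelEmbedding.ext fun i => congr($(h).obj i)

lemma simplexOfChain_mem (x : Fin (n + 1) ↪o X) :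
    simplexOfChain x ∈ (nerve X).nonDegenerate n :=
  (PartialOrder.mem_nerve_nonDegenerate_iff_strictMono _).2 x.strictMono

lemma exists_simplexOfChain {s : (nerve X) _⦋n⦌} (hs : s ∈ (nerve X).nonDegenerate n) :
    ∃ x, simplexOfChain x = s :=
  ⟨OrderEmbedding.ofStrictMono _ ((PartialOrder.mem_nerve_nonDegenerate_iff_strictMono _).1 hs),
    simplex_ext fun _ => rfl⟩

/-- The face of a strict chain obtained by omitting one element. -/
def face (i : Fin (n + 2)) (x : Fin (n + 2) ↪o X) : Fin (n + 1) ↪o X :=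
  (Fin.succAboveOrderEmb i).trans x

@[simp] lemma face_apply (i : Fin (n + 2)) (x : Fin (n + 2) ↪o X) (j : Fin (n + 1)) :
    face i x j = x (i.succAbove j) := rfl

lemma δ_simplexOfChain (i : Fin (n + 2)) (x : Fin (n + 2) ↪o X) :
    (nerve X).δ i (simplexOfChain x) = simplexOfChain (face i x) := rfl

instance [Finite X] : Finite ((nerve X) _⦋n⦌) :=
  Finite.of_injective (fun s i => (s : ComposableArrows X n).obj i)
    fun _ _ h => simplex_ext fun i => congrFun h i

noncomputable instance [Finite X] : Fintype ((nerve X) _⦋n⦌) := Fintype.ofFinite _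

noncomputable instance [Finite X] : Fintype (Fin n ↪o X) := by
  classical
  have := Fintype.ofFinite X
  exact Fintype.ofFinite _

lemma sum_simplex [Finite X] (f : (nerve X) _⦋n⦌ → ℂ)
    (hf : ∀ s, s ∈ (nerve X).degenerate n → f s = 0) :
    ∑ s, f s = ∑ x : Fin (n + 1) ↪o X, f (simplexOfChain x) := by
  symm
  refine Finset.sum_of_injOn simplexOfChain simplexOfChain_injective.injOn (by simp) ?_ (by simp)
  intro s _ hs
  refine hf s ?_
  by_contra hd
  obtain ⟨x, rfl⟩ := exists_simplexOfChain (s := s) hd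
  simp at hs

variable (htop : ∀ x : Fin (n + 3) → X, ¬ StrictMono x)

include htop in
lemma nonDegenerate_eq_empty : (nerve X).nonDegenerate (n + 2) = ∅ := by
  ext s
  simpa using fun hs => htop _ ((PartialOrder.mem_nerve_nonDegenerate_iff_strictMono s).1 hs)

/-- The coefficients at the strict chains of a homology class of top degree. -/
noncomputable def topCoeff :
    ((nerve X).homology (ModuleCat.of ℂ ℂ) (n + 1) : ModuleCat.{0} ℂ) →ₗ[ℂ]
      ((Fin (n + 2) ↪o X) → ℂ) :=
  LinearMap.pi fun x => ((nerve X).normalizedCoeff (simplexOfChain x)).hom ∘ₗ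
    ((nerve X).homologyToNormalized (nonDegenerate_eq_empty htop)).hom

lemma topCoeff_apply
    (z : ((nerve X).homology (ModuleCat.of ℂ ℂ) (n + 1) : ModuleCat.{0} ℂ))
    (x : Fin (n + 2) ↪o X) :
    topCoeff htop z x = ((nerve X).normalizedCoeff (simplexOfChain x)).hom
      (((nerve X).homologyToNormalized (nonDegenerate_eq_empty htop)).hom z) := rfl

lemma topCoeff_injective [Finite X] : Function.Injective (topCoeff htop) := by
  intro z w h
  refine (nerve X).homologyToNormalized_injective (nonDegenerate_eq_empty htop) ?_
  refine (nerve X).normalizedChain_ext fun s hs => ?_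
  obtain ⟨x, rfl⟩ := exists_simplexOfChain hs
  exact congrFun h x

open Classical in
/-- A family of coefficients on the strict chains is a cycle. -/
def IsCycle [Finite X] (f : (Fin (n + 2) ↪o X) → ℂ) : Prop :=
  ∀ t : Fin (n + 1) ↪o X,
    ∑ x, f x * ∑ i : Fin (n + 2), (if face i x = t then (-1 : ℂ) ^ (i : ℕ) else 0) = 0

lemma isCycle_iff_d_eq_zero [Finite X]
    (w : ((nerve X).normalizedChainComplex (ModuleCat.of ℂ ℂ)).X (n + 1)) :
    IsCycle (fun x => ((nerve X).normalizedCoeff (simplexOfChain x)).hom w) ↔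
      (((nerve X).normalizedChainComplex (ModuleCat.of ℂ ℂ)).d (n + 1) n).hom w = 0 := by
  classical
  have key : ∀ t : Fin (n + 1) ↪o X,
      ((nerve X).normalizedCoeff (simplexOfChain t)).hom
        ((((nerve X).normalizedChainComplex (ModuleCat.of ℂ ℂ)).d (n + 1) n).hom w) =
      ∑ x, ((nerve X).normalizedCoeff (simplexOfChain x)).hom w *
        ∑ i : Fin (n + 2), (if face i x = t then (-1 : ℂ) ^ (i : ℕ) else 0) := by
    intro t
    rw [(nerve X).normalizedCoeff_d w _ (simplexOfChain_mem t), sum_simplex]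
    · simp only [δ_simplexOfChain, simplexOfChain_injective.eq_iff]
    · intro s hs
      rw [(nerve X).normalizedCoeff_of_degenerate hs]
      exact zero_mul _
  constructor
  · intro h
    refine (nerve X).normalizedChain_ext fun s hs => ?_
    obtain ⟨t, rfl⟩ := exists_simplexOfChain hs
    rw [key, map_zero]
    convert h t
  · intro h t
    have := key t
    rw [h, map_zero] at this
    convert this.symm

lemma isCycle_topCoeff [Finite X]
    (z : ((nerve X).homology (ModuleCat.of ℂ ℂ) (n + 1) : ModuleCat.{0} ℂ)) :
    IsCycle (topCoeff htop z) :=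
  (isCycle_iff_d_eq_zero _).2 ((nerve X).d_homologyToNormalized (nonDegenerate_eq_empty htop) n z)

lemma exists_topCoeff_eq [Finite X] {f : (Fin (n + 2) ↪o X) → ℂ} (hf : IsCycle f) :
    ∃ z, topCoeff htop z = f := by
  classical
  let w := (nerve X).normalizedChainOf (n := n + 1)
    (fun s => if h : ∃ x, simplexOfChain x = s then f h.choose else 0)
  have hw : ∀ x, ((nerve X).normalizedCoeff (simplexOfChain x)).hom w = f x := by
    intro x
    rw [(nerve X).normalizedCoeff_chainOf _ (simplexOfChain_mem x)]
    have h : ∃ y, simplexOfChain y = simplexOfChain x := ⟨x, rfl⟩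
    rw [dif_pos h, simplexOfChain_injective h.choose_spec]
  have hd := (isCycle_iff_d_eq_zero w).1 (by simpa only [hw] using hf)
  obtain ⟨z, hz⟩ := (nerve X).exists_homologyToNormalized_eq (nonDegenerate_eq_empty htop) n rfl w hd
  refine ⟨z, funext fun x => ?_⟩
  rw [← hw x, ← hz]
  rfl

/-- An injective monotone map only relabels the simplices of the nerve, so no two coefficients are
merged. -/
lemma topCoeff_map [Finite X] {F : X → X} (hF : Monotone F) (hinj : Function.Injective F)
    (z : ((nerve X).homology (ModuleCat.of ℂ ℂ) (n + 1) : ModuleCat.{0} ℂ))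
    (x y : Fin (n + 2) ↪o X) (hxy : ∀ i, y i = F (x i)) :
    topCoeff htop ((SSet.homologyMap (nerveMap hF.functor) (ModuleCat.of ℂ ℂ) (n + 1)).hom z) y =
      topCoeff htop z x := by
  have hy : simplexOfChain y = (nerveMap hF.functor).app _ (simplexOfChain x) :=
    simplex_ext hxy
  have hi : Function.Injective ((nerveMap hF.functor).app (.op ⦋n + 1⦌)) := fun s t h =>
    simplex_ext fun i => hinj congr($(h).obj i)
  have h := (nerve X).homologyToNormalized_map (nonDegenerate_eq_empty htop)
    (nonDegenerate_eq_empty htop) (nerveMap hF.functor) z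
  rw [topCoeff_apply, topCoeff_apply, h, hy]
  exact SSet.normalizedCoeff_map _ hi _ _ (hy ▸ simplexOfChain_mem y)

end PosetHomology

end NormalizedChains

/-! ### Which subsets of the Fano plane are regular of rank three. -/

section BasisCriterion

variable {K : Type*} [Field K] {α : Type*} {r : ℕ}

/-- A set of vectors in `Kʳ` is independent iff it extends to `r` members of a given spanning family
with nonzero determinant. -/
theorem linearIndepOn_iff_exists_det_ne_zero {v : α → Fin r → K} {E I : Set α}
    (hE : Submodule.span K (v '' E) = ⊤) (hI : I ⊆ E) :
    LinearIndepOn K v I ↔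
      ∃ b : Fin r → α, (∀ i, b i ∈ E) ∧ I ⊆ Set.range b ∧ (Matrix.of (v ∘ b)).det ≠ 0 := by
  constructor
  · intro h
    -- An independent set extended maximally inside the spanning set `E` is a basis, hence has `r`
    -- elements.
    obtain ⟨B, hBE, hIB, hsp, hB⟩ := exists_linearIndepOn_extension h hI
    have hspan : ⊤ ≤ Submodule.span K (Set.range fun x : B => v x) := by
      rw [← hE, Submodule.span_le]
      simpa [Set.image_eq_range] using hsp
    let bas := Module.Basis.mk (v := fun x : B => v x) hB hspan
    have := Fintype.ofFinite (Module.Free.ChooseBasisIndex K (Fin r → K))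
    have : Finite B := Module.Finite.finite_basis bas
    have := Fintype.ofFinite B
    have hc : Fintype.card B = Fintype.card (Fin r) := by
      rw [← Module.finrank_eq_card_basis bas]; simp
    let e : Fin r ≃ B := (Fintype.equivOfCardEq hc).symm
    refine ⟨fun i => e i, fun i => hBE (e i).2, fun x hx => ⟨e.symm ⟨x, hIB hx⟩, by simp⟩, ?_⟩
    rw [← isUnit_iff_ne_zero, ← Matrix.isUnit_iff_isUnit_det,
      ← Matrix.linearIndependent_rows_iff_isUnit]
    exact hB.comp e e.injective
  · rintro ⟨b, -, hIb, hdet⟩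
    rw [← isUnit_iff_ne_zero, ← Matrix.isUnit_iff_isUnit_det,
      ← Matrix.linearIndependent_rows_iff_isUnit] at hdet
    have hdet : LinearIndependent K (v ∘ b) := hdet
    have hb : Function.Injective b := fun i j hij => hdet.injective (by simp [hij])
    exact ((linearIndepOn_range_iff hb v).2 hdet).mono hIb

end BasisCriterion

namespace RegularMatroid

/-- The seven points of the Fano plane, listed along a Singer cycle. -/
def pt : Fin 7 → Fin 3 → ZMod 2 :=
  ![![1, 0, 0], ![0, 1, 0], ![0, 0, 1], ![1, 1, 0], ![0, 1, 1], ![1, 1, 1], ![1, 0, 1]]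

lemma pt_injective : Function.Injective pt := by decide

lemma pt_ne_zero : ∀ i, pt i ≠ 0 := by decide

lemma exists_pt_eq : ∀ v : Fin 3 → ZMod 2, v ≠ 0 → ∃ i, pt i = v := by decide

/-- An integral lift of the points of the Fano plane: the graphic representation of `M(K₄)` on all
points but `(1, 1, 1)`. -/
def lift (v : Fin 3 → ZMod 2) : Fin 3 → ℤ :=
  ![(v 0).val, (v 1).val * (1 - 2 * (v 0).val),
    (v 2).val * (1 - 2 * (v 0).val) * (1 - 2 * (v 1).val)]

lemma lift_cast (v : Fin 3 → ZMod 2) (i : Fin 3) : ((lift v i : ℤ) : ZMod 2) = v i := by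
  revert v i; decide

lemma lift_det_three : ∀ i j k : Fin 7, i ≠ 5 → j ≠ 5 → k ≠ 5 →
    let a := lift (pt i); let b := lift (pt j); let c := lift (pt k)
    let d := a 0 * b 1 * c 2 - a 0 * b 2 * c 1 - a 1 * b 0 * c 2 + a 1 * b 2 * c 0
      + a 2 * b 0 * c 1 - a 2 * b 1 * c 0
    d = 0 ∨ d = -1 ∨ d = 1 := by
  decide

/-- Point 5 has to be left out: its lift (1, -1, 1) and the lift (1, 0, -1) of point 6 have a minor
equal to 2. -/
lemma lift_det_two : ∀ i j : Fin 7, i ≠ 5 → j ≠ 5 → ∀ r s : Fin 3,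
    let a := lift (pt i); let b := lift (pt j)
    let d := a r * b s - a s * b r
    d = 0 ∨ d = -1 ∨ d = 1 := by
  decide

lemma lift_det_one : ∀ i : Fin 7, ∀ r : Fin 3,
    lift (pt i) r = 0 ∨ lift (pt i) r = -1 ∨ lift (pt i) r = 1 := by
  decide

lemma mem_range_signType_cast {R : Type*} [Ring R] {d : ℤ} (h : d = 0 ∨ d = -1 ∨ d = 1) :
    (d : R) ∈ Set.range (SignType.cast : SignType → R) := by
  rcases h with rfl | rfl | rfl
  · exact ⟨0, by simp⟩
  · exact ⟨-1, by simp⟩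
  · exact ⟨1, by simp⟩

lemma lift_matrix_det (b : Fin 3 → Fin 7) (hb : ∀ i, b i ≠ 5) :
    (Matrix.of fun i => lift (pt (b i))).det = 0 ∨ (Matrix.of fun i => lift (pt (b i))).det = -1 ∨
      (Matrix.of fun i => lift (pt (b i))).det = 1 := by
  have := lift_det_three (b 0) (b 1) (b 2) (hb 0) (hb 1) (hb 2)
  rw [Matrix.det_fin_three]
  exact this

lemma lift_isTotallyUnimodular :
    ((Matrix.of fun (r : Fin 3) (i : {i : Fin 7 // i ≠ 5}) =>
      (lift (pt i) r : ℝ))).IsTotallyUnimodular := by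
  intro k f g hf hg
  have hcast : ∀ (f : Fin k → Fin 3) (g : Fin k → {i : Fin 7 // i ≠ 5}),
      ((Matrix.of fun (r : Fin 3) (i : {i : Fin 7 // i ≠ 5}) =>
      (lift (pt i) r : ℝ)).submatrix f g).det =
      (((Matrix.of fun (i j : Fin k) => lift (pt (g i)) (f j)).det : ℤ) : ℝ) := by
    intro f g
    rw [← Matrix.det_transpose, ← eq_intCast (Int.castRingHom ℝ), RingHom.map_det]
    rfl
  have hk : k ≤ 3 := by simpa using Fintype.card_le_of_injective f hf
  rw [hcast]
  apply mem_range_signType_cast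
  interval_cases k
  · simp
  · simpa using lift_det_one (g 0) (f 0)
  · rw [Matrix.det_fin_two]
    exact lift_det_two (g 0) (g 1) (g 0).2 (g 1).2 (f 0) (f 1)
  -- A minor of size 3 uses every row, so `f` is a permutation and affects only the sign.
  · obtain ⟨e, he⟩ : ∃ e : Equiv.Perm (Fin 3), ⇑e = f :=
      ⟨Equiv.ofBijective f (Finite.injective_iff_bijective.1 hf), rfl⟩
    have h1 := lift_matrix_det (fun i => g i) (fun i => (g i).2)
    have h2 := Matrix.det_permute' e (Matrix.of fun i => lift (pt (g i)))
    have h3 : ((Matrix.of fun i => lift (pt (g i))).submatrix id e) =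
        Matrix.of fun i j => lift (pt (g i)) (f j) := by
      rw [← he]; rfl
    rw [← h3, h2]
    rcases Int.units_eq_one_or (Equiv.Perm.sign e) with h | h <;> rw [h] <;>
      rcases h1 with h1 | h1 | h1 <;> simp [h1]

/-- The complement in the Fano plane of a set of indices. -/
def comp (S : Finset (Fin 7)) : Set (Fin 3 → ZMod 2) := {v | ∃ i, i ∉ S ∧ pt i = v}

lemma pt_mem_comp {S : Finset (Fin 7)} {i : Fin 7} : pt i ∈ comp S ↔ i ∉ S :=
  ⟨fun ⟨_, hj, h⟩ => pt_injective h ▸ hj, fun h => ⟨i, h, rfl⟩⟩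

lemma comp_anti {S T : Finset (Fin 7)} : comp S ⊆ comp T ↔ T ⊆ S := by
  constructor
  · intro h i hi
    by_contra hS
    exact pt_mem_comp.1 (h (pt_mem_comp.2 hS)) hi
  · rintro h _ ⟨i, hi, rfl⟩
    exact ⟨i, fun hT => hi (h hT), rfl⟩

lemma isRegular_mono {r : ℕ} {E F : Set (Fin r → ZMod 2)} (hF : IsRegular (binaryMatroid F))
    (h : E ⊆ F) : IsRegular (binaryMatroid E) := by
  obtain ⟨n, A, hA, hind⟩ := hF
  refine ⟨n, A, ?_, fun I hI => ?_⟩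
  · exact hA.submatrix (id : Fin n → Fin n) (fun x : E => (⟨x.1, h x.2⟩ : F))
  · rw [← hind I (hI.trans h)]
    have hI' : I ⊆ E := hI
    simp [hI', hI'.trans h]

/-- The integral lift as a real matrix, whose columns are indexed by vectors over `𝔽₂`. -/
def liftMatrix : Matrix (Fin 3) (Fin 3 → ZMod 2) ℝ := Matrix.of fun r v => (lift v r : ℝ)

lemma liftMatrix_apply (r : Fin 3) (v : Fin 3 → ZMod 2) : liftMatrix r v = lift v r := rfl

lemma isRegular_comp_singleton_five : IsRegular (binaryMatroid (comp {5})) := by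
  refine ⟨3, liftMatrix, ?_, fun I hI => ?_⟩
  · change (liftMatrix.submatrix id (Subtype.val : comp {5} → _)).IsTotallyUnimodular
    have hex : ∀ x : comp {5}, ∃ i : {i : Fin 7 // i ≠ 5}, pt i = x := by
      rintro ⟨_, i, hi, rfl⟩
      exact ⟨⟨i, by simpa using hi⟩, rfl⟩
    choose g hg using hex
    have := lift_isTotallyUnimodular.submatrix (id : Fin 3 → Fin 3) g
    rw [show liftMatrix.submatrix id (Subtype.val : comp {5} → Fin 3 → ZMod 2) = _ from
      Matrix.ext fun r x => congr((lift $((hg x).symm) r : ℝ))]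
    exact this
  · have hI : I ⊆ comp {5} := hI
    have h012 : ∀ j : Fin 3, pt (Fin.castLE (by decide) j) ∈ comp {5} := fun j =>
      pt_mem_comp.2 (by revert j; decide)
    have hpt : ∀ j k : Fin 3, pt (Fin.castLE (by decide) j) k = if k = j then 1 else 0 := by decide
    have hl : ∀ j k : Fin 3, lift (pt (Fin.castLE (by decide) j)) k = if k = j then 1 else 0 := by
      decide
    -- Points 0, 1, 2 are the unit vectors and lift to unit vectors. Both families therefore span,
    -- and independence over either field is read off from 3 × 3 determinants.
    have hspan : ∀ (K : Type) [Field K] (v : (Fin 3 → ZMod 2) → Fin 3 → K),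
        (∀ j, v (pt (Fin.castLE (by decide) j)) = Pi.single j 1) →
        Submodule.span K (v '' comp {5}) = ⊤ := by
      intro K _ v hv
      rw [← top_le_iff, ← (Pi.basisFun K (Fin 3)).span_eq, Submodule.span_le]
      rintro _ ⟨j, rfl⟩
      refine Submodule.subset_span ⟨_, h012 j, ?_⟩
      rw [hv, Pi.basisFun_apply]
    have h2 := hspan (ZMod 2) id fun j => by ext k; simp [hpt, Pi.single_apply]
    have hR := hspan ℝ liftMatrix.col fun j => by
      ext k; simp [liftMatrix_apply, hl, Pi.single_apply]
    rw [binaryMatroid_indep_iff, and_iff_right hI, linearIndepOn_iff_exists_det_ne_zero h2 hI,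
      linearIndepOn_iff_exists_det_ne_zero hR hI]
    refine exists_congr fun b => and_congr_right fun hb => and_congr_right fun _ => ?_
    choose c hc hcb using hb
    have hc5 : ∀ i, c i ≠ 5 := fun i => by simpa using hc i
    have e2 : (Matrix.of ((id : (Fin 3 → ZMod 2) → _) ∘ b)).det =
        (((Matrix.of fun i => lift (pt (c i))).det : ℤ) : ZMod 2) := by
      rw [← eq_intCast (Int.castRingHom (ZMod 2)), RingHom.map_det]
      congr 1
      ext i j
      simp [lift_cast, hcb]
    have eR : (Matrix.of (liftMatrix.col ∘ b)).det =
        (((Matrix.of fun i => lift (pt (c i))).det : ℤ) : ℝ) := by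
      rw [← eq_intCast (Int.castRingHom ℝ), RingHom.map_det]
      congr 1
      ext i j
      simp [hcb, liftMatrix_apply]
    rw [e2, eR]
    -- An integer in {0, 1, -1} vanishes modulo 2 exactly when it vanishes in ℝ.
    rcases lift_matrix_det c hc5 with h | h | h <;> simp [h]

open Matrix in
/-- A Singer cycle of order `7` in `SL(3, 𝔽₂)`. -/
def singer : Matrix.SpecialLinearGroup (Fin 3) (ZMod 2) :=
  ⟨!![0, 0, 1; 1, 0, 1; 0, 1, 0], by decide⟩

lemma singer_mulVec_pt : ∀ i, (singer : Matrix _ _ (ZMod 2)).mulVec (pt i) = pt (i + 1) := by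
  decide

/-- The Singer cycle permutes the points transitively and carries the case of point 5 to all others.
-/
lemma isRegular_comp_singleton (j : Fin 7) : IsRegular (binaryMatroid (comp {j})) := by
  suffices h : ∀ m : ℕ, IsRegular (binaryMatroid (comp {5 + Fin.ofNat 7 m})) by
    have := h (j - 5).val
    simpa using this
  intro m
  induction m with
  | zero => exact isRegular_comp_singleton_five
  | succ m ih =>
    have := ih.map (Matrix.SpecialLinearGroup.toLin' singer).toEquiv
    rw [← binaryMatroid_image] at this
    convert this using 2
    have hs : (5 : Fin 7) + Fin.ofNat 7 (m + 1) = 5 + Fin.ofNat 7 m + 1 := by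
      rw [add_assoc]; congr 1
      ext; simp [Fin.val_add]
    rw [hs]
    generalize 5 + Fin.ofNat 7 m = k
    ext v
    constructor
    · rintro ⟨i, hi, rfl⟩
      refine ⟨pt (i - 1), pt_mem_comp.2 ?_, ?_⟩
      · simpa [sub_eq_iff_eq_add] using hi
      · have := singer_mulVec_pt (i - 1)
        rwa [sub_add_cancel] at this
    · rintro ⟨_, ⟨i, hi, rfl⟩, rfl⟩
      refine ⟨i + 1, by simpa using hi, (singer_mulVec_pt i).symm⟩

/-- In a linear relation among pairwise independent vectors, one zero coefficient would force the
others to vanish; hence all three are nonzero. -/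
lemma exists_smul_add_smul {V : Type*} [AddCommGroup V] [Module ℝ V] {u v w : V}
    (h : ¬ LinearIndependent ℝ ![u, v, w]) (huv : LinearIndependent ℝ ![u, v])
    (huw : LinearIndependent ℝ ![u, w]) (hvw : LinearIndependent ℝ ![v, w]) :
    ∃ a b : ℝ, a ≠ 0 ∧ b ≠ 0 ∧ w = a • u + b • v := by
  rw [Fintype.not_linearIndependent_iff] at h
  obtain ⟨g, hg, i, hi⟩ := h
  have hi' : g 0 ≠ 0 ∨ g 1 ≠ 0 ∨ g 2 ≠ 0 := by
    fin_cases i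
    exacts [Or.inl hi, Or.inr (Or.inl hi), Or.inr (Or.inr hi)]
  rw [LinearIndependent.pair_iff] at huv huw hvw
  rw [Fin.sum_univ_three] at hg
  generalize g 0 = a at *
  generalize g 1 = b at *
  generalize g 2 = c at *
  change a • u + b • v + c • w = 0 at hg
  have hc : c ≠ 0 := by
    rintro rfl
    have := huv a b (by simpa using hg)
    tauto
  have ha : a ≠ 0 := by
    rintro rfl
    exact hc (hvw b c (by simpa using hg)).2
  have hb : b ≠ 0 := by
    rintro rfl
    exact hc (huw a c (by simpa using hg)).2
  refine ⟨-(a / c), -(b / c), by simp [ha, hc], by simp [hb, hc], ?_⟩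
  have : w = -c⁻¹ • (a • u + b • v) := by
    rw [eq_neg_of_add_eq_zero_left hg]
    simp [smul_smul, hc]
  rw [this]
  module

/-- The Fano plane is not representable over ℝ. In the basis formed by points 0, 1, 2, the seven
collinearities, all with nonzero coefficients, force `2 * d4 * b2 = 0`, which is harmless only in
characteristic two. -/
lemma not_isRegular_comp_empty : ¬ IsRegular (binaryMatroid (comp ∅)) := by
  rintro ⟨n, A, -, hind⟩
  have key : ∀ (k : ℕ) (b : Fin k → Fin 7), Function.Injective b →
      (LinearIndependent ℝ (A.col ∘ pt ∘ b) ↔ LinearIndependent (ZMod 2) (pt ∘ b)) := by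
    intro k b hb
    have hinj := pt_injective.comp hb
    have hsub : Set.range (pt ∘ b) ⊆ comp ∅ := by
      rintro _ ⟨i, rfl⟩
      exact pt_mem_comp.2 (by simp)
    rw [← linearIndepOn_range_iff hinj A.col, ← hind _ hsub, binaryMatroid_indep_iff,
      and_iff_right hsub, linearIndepOn_range_iff hinj id]
    rfl
  have hpair2 : ∀ i j : Fin 7, i ≠ j → ∀ s t : ZMod 2, s • pt i + t • pt j = 0 → s = 0 ∧ t = 0 := by
    decide
  have hpair : ∀ i j, i ≠ j → LinearIndependent ℝ ![A.col (pt i), A.col (pt j)] := by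
    intro i j hij
    have h := key 2 ![i, j] (by intro a b; fin_cases a <;> fin_cases b <;> simp [hij, hij.symm])
    have e1 : A.col ∘ pt ∘ ![i, j] = ![A.col (pt i), A.col (pt j)] := by
      ext a; fin_cases a <;> rfl
    have e2 : pt ∘ ![i, j] = ![pt i, pt j] := by
      ext a; fin_cases a <;> rfl
    rw [e1, e2] at h
    rw [h, LinearIndependent.pair_iff]
    exact hpair2 i j hij
  have htriple : ∀ i j k, i ≠ j → i ≠ k → j ≠ k →
      (LinearIndependent ℝ ![A.col (pt i), A.col (pt j), A.col (pt k)] ↔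
        LinearIndependent (ZMod 2) ![pt i, pt j, pt k]) := by
    intro i j k hij hik hjk
    have h := key 3 ![i, j, k] (by
      intro a b
      fin_cases a <;> fin_cases b <;> simp [hij, hij.symm, hik, hik.symm, hjk, hjk.symm])
    have e1 : A.col ∘ pt ∘ ![i, j, k] = ![A.col (pt i), A.col (pt j), A.col (pt k)] := by
      ext a; fin_cases a <;> rfl
    have e2 : pt ∘ ![i, j, k] = ![pt i, pt j, pt k] := by
      ext a; fin_cases a <;> rfl
    rwa [e1, e2] at h
  have hline : ∀ i j k, i ≠ j → i ≠ k → j ≠ k → pt i + pt j + pt k = 0 →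
      ∃ a b : ℝ, a ≠ 0 ∧ b ≠ 0 ∧ A.col (pt k) = a • A.col (pt i) + b • A.col (pt j) := by
    intro i j k hij hik hjk hs
    refine exists_smul_add_smul ?_ (hpair i j hij) (hpair i k hik) (hpair j k hjk)
    rw [htriple i j k hij hik hjk, Fintype.not_linearIndependent_iff]
    exact ⟨fun _ => 1, by simpa [Fin.sum_univ_three] using hs, 0, one_ne_zero⟩
  have hbasis : LinearIndependent ℝ ![A.col (pt 0), A.col (pt 1), A.col (pt 2)] := by
    rw [htriple 0 1 2 (by decide) (by decide) (by decide), Fintype.linearIndependent_iff]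
    decide
  have hzero : ∀ a b c : ℝ, a • A.col (pt 0) + b • A.col (pt 1) + c • A.col (pt 2) = 0 →
      a = 0 ∧ b = 0 ∧ c = 0 := by
    intro a b c h
    have := Fintype.linearIndependent_iff.1 hbasis ![a, b, c]
      (by simpa [Fin.sum_univ_three] using h)
    exact ⟨this 0, this 1, this 2⟩
  obtain ⟨a1, a2, ha1, ha2, h3⟩ := hline 0 1 3 (by decide) (by decide) (by decide) (by decide)
  obtain ⟨b2, b3, hb2, hb3, h4⟩ := hline 1 2 4 (by decide) (by decide) (by decide) (by decide)
  obtain ⟨c1, c3, hc1, hc3, h6⟩ := hline 0 2 6 (by decide) (by decide) (by decide) (by decide)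
  obtain ⟨f, g, hf, hg, h5⟩ := hline 3 2 5 (by decide) (by decide) (by decide) (by decide)
  obtain ⟨d1, d4, hd1, hd4, h5'⟩ := hline 0 4 5 (by decide) (by decide) (by decide) (by decide)
  obtain ⟨k, h, hk, hh, h5''⟩ := hline 1 6 5 (by decide) (by decide) (by decide) (by decide)
  obtain ⟨p, q, hp, hq, h6'⟩ := hline 3 4 6 (by decide) (by decide) (by decide) (by decide)
  rw [h3] at h5 h6'
  rw [h4] at h5' h6'
  rw [h6] at h5'' h6'
  obtain ⟨e1, e2, e3⟩ := hzero (f * a1 - d1) (f * a2 - d4 * b2) (g - d4 * b3) (by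
    rw [← sub_eq_zero.2 (h5.symm.trans h5')]; module)
  obtain ⟨e4, e5, e6⟩ := hzero (f * a1 - h * c1) (f * a2 - k) (g - h * c3) (by
    rw [← sub_eq_zero.2 (h5.symm.trans h5'')]; module)
  obtain ⟨e7, e8, e9⟩ := hzero (c1 - p * a1) (-(p * a2 + q * b2)) (c3 - q * b3) (by
    rw [← sub_eq_zero.2 h6']; module)
  have hx : a1 * (f - h * p) = 0 := by linear_combination e4 + h * e7
  have hy : b3 * (d4 - h * q) = 0 := by linear_combination e6 - e3 + h * e9
  have hx' : f = h * p := by simpa [ha1, sub_eq_zero] using hx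
  have hy' : d4 = h * q := by simpa [hb3, sub_eq_zero] using hy
  have : d4 * b2 = 0 := by
    linear_combination -(1 / 2 : ℝ) * e2 + (1 / 2 : ℝ) * a2 * hx' + (1 / 2 : ℝ) * b2 * hy'
      - (1 / 2 : ℝ) * h * e8
  simp [hd4, hb2] at this

/-- The complements of the lines of the Fano plane. -/
def lineCompl (i : Fin 7) : Finset (Fin 7) := {i + 2, i + 4, i + 5, i + 6}

/-- The index sets whose complements in the Fano plane are regular of rank three. -/
abbrev IsGood (S : Finset (Fin 7)) : Prop := S.Nonempty ∧ ∀ i, ¬ lineCompl i ⊆ S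

lemma zero_notMem_comp (S : Finset (Fin 7)) : (0 : Fin 3 → ZMod 2) ∉ comp S := by
  rintro ⟨i, -, h⟩
  exact pt_ne_zero i h

lemma encard_le_three_of_linearIndepOn {I : Set (Fin 3 → ZMod 2)}
    (h : LinearIndepOn (ZMod 2) id I) : I.encard ≤ 3 := by
  have hf : I.Finite := I.toFinite
  have := Fintype.ofFinite I
  have := h.fintype_card_le_finrank
  rw [Set.encard_eq_coe_toFinset_card, Set.toFinset_card]
  simp only [Module.finrank_fintype_fun_eq_card, Fintype.card_fin] at this
  exact_mod_cast this

/-- If the span were proper, a nonzero functional would kill it. The points where such a functional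
does not vanish form the complement of a line, which would then lie inside `S`. -/
lemma span_comp_eq_top {S : Finset (Fin 7)} (hS : ∀ i, ¬ lineCompl i ⊆ S) :
    Submodule.span (ZMod 2) (id '' comp S) = ⊤ := by
  by_contra hne
  obtain ⟨f, hf, hle⟩ := Submodule.exists_le_ker_of_lt_top _ (lt_top_iff_ne_top.2 hne)
  have hfv : ∀ v, f v = ∑ k, v k * f (Pi.single k 1) := by
    intro v
    conv_lhs => rw [pi_eq_sum_univ' v]
    simp [map_sum]
  have hw : (fun k => f (Pi.single k 1)) ≠ 0 := by
    intro hw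
    apply hf
    ext k
    simpa using congrFun hw k
  have hdec : ∀ w : Fin 3 → ZMod 2, w ≠ 0 → ∃ i, ∀ j ∈ lineCompl i, ∑ k, pt j k * w k ≠ 0 := by
    decide
  obtain ⟨i, hi⟩ := hdec _ hw
  refine hS i fun j hj => ?_
  by_contra hjS
  have := hle (Submodule.subset_span ⟨pt j, pt_mem_comp.2 hjS, rfl⟩)
  exact hi j hj (by rw [← hfv]; exact this)

/-- Membership in `IR(3, 𝔽₂)` in terms of complements. -/
theorem comp_mem_iff (S : Finset (Fin 7)) :
    ((0 : Fin 3 → ZMod 2) ∉ comp S ∧ IsRegular (binaryMatroid (comp S)) ∧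
      (binaryMatroid (comp S)).eRank = (3 : ℕ)) ↔ IsGood S := by
  constructor
  · rintro ⟨-, hreg, hrk⟩
    refine ⟨?_, fun i hi => ?_⟩
    · rw [Finset.nonempty_iff_ne_empty]
      rintro rfl
      exact not_isRegular_comp_empty hreg
    · obtain ⟨B, hB⟩ := (binaryMatroid (comp S)).exists_isBase
      have hB3 : B.encard = (3 : ℕ) := hB.encard_eq_eRank.trans hrk
      obtain ⟨hBS, hBi⟩ := (binaryMatroid_indep_iff _ _).1 hB.indep
      -- A base has three elements and lies on a line of three points, so it is that line; but the
      -- points of a line sum to zero.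
      let Ln : Finset (Fin 3 → ZMod 2) := {pt i, pt (i + 1), pt (i + 3)}
      have hBL : B ⊆ Ln := by
        intro v hv
        obtain ⟨j, hj, rfl⟩ := hBS hv
        have hdec : ∀ i j, j ∉ lineCompl i →
            pt j ∈ ({pt i, pt (i + 1), pt (i + 3)} : Finset (Fin 3 → ZMod 2)) := by decide
        exact hdec i j fun h => hj (hi h)
      have hL : (Ln : Set (Fin 3 → ZMod 2)).encard ≤ 3 := by
        rw [Set.encard_coe_eq_coe_finsetCard]
        exact_mod_cast Finset.card_le_three
      have hBL' : B = Ln := Set.Finite.eq_of_subset_of_encard_le (Set.toFinite _) hBL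
        (by rw [hB3]; exact hL)
      rw [hBL'] at hBi
      have hinj : Function.Injective ![pt i, pt (i + 1), pt (i + 3)] := by
        have hdec : ∀ i, Function.Injective ![pt i, pt (i + 1), pt (i + 3)] := by decide
        exact hdec i
      have hsum : ∑ k, (1 : ZMod 2) • ![pt i, pt (i + 1), pt (i + 3)] k = 0 := by
        have hdec : ∀ i, ∑ k, (1 : ZMod 2) • ![pt i, pt (i + 1), pt (i + 3)] k = 0 := by decide
        exact hdec i
      have hli : LinearIndependent (ZMod 2) ![pt i, pt (i + 1), pt (i + 3)] := by
        have h1 := (linearIndepOn_range_iff (R := ZMod 2) hinj id).1 (by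
          convert hBi using 1
          ext v
          simp [Ln, Matrix.range_cons, or_comm, or_left_comm])
        exact h1
      rw [Fintype.linearIndependent_iff] at hli
      have h0 := hli (fun _ => 1) hsum 0
      exact one_ne_zero h0
  · rintro ⟨⟨j, hj⟩, hS⟩
    refine ⟨zero_notMem_comp S, isRegular_mono (isRegular_comp_singleton j)
      (comp_anti.2 (by simpa using hj)), le_antisymm ?_ ?_⟩
    · obtain ⟨B, hB⟩ := (binaryMatroid (comp S)).exists_isBase
      rw [← hB.encard_eq_eRank]
      exact encard_le_three_of_linearIndepOn ((binaryMatroid_indep_iff _ _).1 hB.indep).2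
    · obtain ⟨b, hb, -, hdet⟩ := (linearIndepOn_iff_exists_det_ne_zero
        (span_comp_eq_top hS) (Set.empty_subset _)).1 (linearIndepOn_empty (ZMod 2) id)
      have hbs : Set.range b ⊆ comp S := by rintro _ ⟨i, rfl⟩; exact hb i
      have hbi : LinearIndepOn (ZMod 2) id (Set.range b) :=
        (linearIndepOn_iff_exists_det_ne_zero (span_comp_eq_top hS) hbs).2
          ⟨b, hb, subset_rfl, hdet⟩
      rw [← isUnit_iff_ne_zero, ← Matrix.isUnit_iff_isUnit_det,
        ← Matrix.linearIndependent_rows_iff_isUnit] at hdet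
      have hinj : Function.Injective b := fun i j hij => hdet.injective hij
      have := (binaryMatroid_indep_iff (comp S) _).2 ⟨hbs, hbi⟩ |>.encard_le_eRank
      rw [← Set.image_univ, hinj.encard_image, Set.encard_univ] at this
      simpa using this

lemma exists_eq_comp {E : Set (Fin 3 → ZMod 2)} (h : (0 : Fin 3 → ZMod 2) ∉ E) :
    ∃ S, E = comp S := by
  classical
  refine ⟨Finset.univ.filter fun i => pt i ∉ E, Set.ext fun v => ⟨fun hv => ?_, ?_⟩⟩
  · obtain ⟨i, rfl⟩ := exists_pt_eq v (by rintro rfl; exact h hv)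
    exact pt_mem_comp.2 (by simpa using hv)
  · rintro ⟨i, hi, rfl⟩
    simpa using hi

open PosetHomology
/-! ### Maximal chains of `IR(3, 𝔽₂)` -/

/-- The element of `IR(3, 𝔽₂)` omitting a good set of points. -/
def elt (S : Finset (Fin 7)) (h : IsGood S) : IR 3 := ⟨comp S, (comp_mem_iff S).2 h⟩

lemma elt_le_iff {S T : Finset (Fin 7)} {hS : IsGood S} {hT : IsGood T} :
    elt S hS ≤ elt T hT ↔ T ⊆ S := comp_anti

lemma elt_inj {S T : Finset (Fin 7)} {hS : IsGood S} {hT : IsGood T} :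
    elt S hS = elt T hT ↔ S = T := by
  rw [le_antisymm_iff, elt_le_iff, elt_le_iff, and_comm, ← Finset.Subset.antisymm_iff]

lemma exists_elt (E : IR 3) : ∃ S h, elt S h = E := by
  obtain ⟨S, hS⟩ := exists_eq_comp E.2.1
  exact ⟨S, (comp_mem_iff S).1 (hS ▸ E.2), Subtype.ext hS.symm⟩

-- Any two points lie on a line, so five or more points always contain the complement of a line.
set_option maxRecDepth 20000 in
lemma card_le_four_of_isGood : ∀ S : Finset (Fin 7), IsGood S → S.card ≤ 4 := by decide

lemma card_strictAnti {n : ℕ} {x : Fin n → IR 3} (hx : StrictMono x) (S : Fin n → Finset (Fin 7))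
    (hS : ∀ i, ∃ h, elt (S i) h = x i) {i j : Fin n} (hij : i < j) : S j ⊂ S i := by
  have h := hx hij
  obtain ⟨hi, ei⟩ := hS i
  obtain ⟨hj, ej⟩ := hS j
  rw [← ei, ← ej, lt_iff_le_not_ge, elt_le_iff, elt_le_iff] at h
  exact h

lemma no_long_chain (x : Fin (2 + 3) → IR 3) : ¬ StrictMono x := by
  intro hx
  choose S hS hx' using fun i => exists_elt (x i)
  have h : ∀ {i j : Fin 5}, i < j → (S j).card < (S i).card := fun hij =>
    Finset.card_lt_card (card_strictAnti hx S (fun i => ⟨hS i, hx' i⟩) hij)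
  have h01 := h (show (0 : Fin 5) < 1 by decide)
  have h12 := h (show (1 : Fin 5) < 2 by decide)
  have h23 := h (show (2 : Fin 5) < 3 by decide)
  have h34 := h (show (3 : Fin 5) < 4 by decide)
  have h0 := card_le_four_of_isGood _ (hS 0)
  have h4 := (hS 4).1.card_pos
  omega

/-- Four distinct points whose complement is not a line. -/
abbrev Valid (d : Fin 4 → Fin 7) : Prop :=
  Function.Injective d ∧ ∀ i, ¬ lineCompl i ⊆ Finset.univ.image d

/-- The points omitted by the `k`-th element of the chain attached to `d`. -/
def omitted (d : Fin 4 → Fin 7) (k : Fin 4) : Finset (Fin 7) :=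
  (Finset.univ.filter fun j : Fin 4 => j.val + k.val ≤ 3).image d

lemma omitted_zero (d : Fin 4 → Fin 7) : omitted d 0 = insert (d 3) (insert (d 2) {d 1, d 0}) := by
  rw [omitted, show (Finset.univ.filter fun j : Fin 4 => j.val + (0 : Fin 4).val ≤ 3) =
    {3, 2, 1, 0} by decide]
  simp

lemma omitted_one (d : Fin 4 → Fin 7) : omitted d 1 = insert (d 2) {d 1, d 0} := by
  rw [omitted, show (Finset.univ.filter fun j : Fin 4 => j.val + (1 : Fin 4).val ≤ 3) =
    {2, 1, 0} by decide]
  simp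

lemma omitted_two (d : Fin 4 → Fin 7) : omitted d 2 = {d 1, d 0} := by
  rw [omitted, show (Finset.univ.filter fun j : Fin 4 => j.val + (2 : Fin 4).val ≤ 3) =
    {1, 0} by decide]
  simp

lemma omitted_three (d : Fin 4 → Fin 7) : omitted d 3 = {d 0} := by
  rw [omitted, show (Finset.univ.filter fun j : Fin 4 => j.val + (3 : Fin 4).val ≤ 3) =
    {0} by decide]
  simp

lemma isGood_omitted {d : Fin 4 → Fin 7} (hd : Valid d) (k : Fin 4) : IsGood (omitted d k) := by
  refine ⟨⟨d 0, Finset.mem_image_of_mem d ?_⟩, fun i hi => hd.2 i (hi.trans ?_)⟩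
  · simp; omega
  · exact Finset.image_subset_image (Finset.filter_subset _ _)

lemma card_omitted {d : Fin 4 → Fin 7} (hd : Valid d) (k : Fin 4) :
    (omitted d k).card = 4 - k.val := by
  rw [omitted, Finset.card_image_of_injective _ hd.1]
  revert k; decide

lemma omitted_anti (d : Fin 4 → Fin 7) {k l : Fin 4} (h : k ≤ l) : omitted d l ⊆ omitted d k :=
  Finset.image_subset_image fun j => by
    have : k.val ≤ l.val := h
    simp only [Finset.mem_filter, Finset.mem_univ, true_and]
    omega

/-- The type of orderings of complements of bases of the Fano plane. -/
abbrev ValidTuple : Type := {d : Fin 4 → Fin 7 // Valid d}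

/-- The maximal chain of `IR(3, 𝔽₂)` attached to an ordering of the complement of a basis. -/
def chain (d : ValidTuple) : Fin 4 ↪o IR 3 :=
  OrderEmbedding.ofStrictMono (fun k => elt (omitted d k) (isGood_omitted d.2 k)) fun k l h => by
    refine lt_of_le_of_ne (elt_le_iff.2 (omitted_anti _ h.le)) fun he => ?_
    have := congrArg Finset.card (elt_inj.1 he)
    rw [card_omitted d.2, card_omitted d.2] at this
    have : k.val < l.val := h
    omega

lemma chain_apply (d : ValidTuple) (k : Fin 4) :
    chain d k = elt (omitted d k) (isGood_omitted d.2 k) := rfl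

lemma face_chain_eq_iff (k : Fin 4) (d e : ValidTuple) :
    face k (chain d) = face k (chain e) ↔ ∀ l, l ≠ k → omitted d l = omitted e l := by
  constructor
  · intro h l hl
    obtain ⟨j, rfl⟩ := Fin.exists_succAbove_eq hl
    have := congr($h j)
    rw [face_apply, face_apply, chain_apply, chain_apply, elt_inj] at this
    exact this
  · intro h
    refine RelEmbedding.ext fun j => ?_
    change face k (chain d) j = face k (chain e) j
    rw [face_apply, face_apply, chain_apply, chain_apply, elt_inj]
    exact h _ (Fin.succAbove_ne _ _)

/-- The sizes of the omitted sets, 4, 3, 2, 1 along a chain, reveal which index a face skips. Hence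
no cancellation occurs between faces of different index. -/
lemma index_eq_of_face_chain_eq {i k : Fin 4} {d e : ValidTuple}
    (h : face i (chain d) = face k (chain e)) : i = k := by
  have hj : ∀ j : Fin 3, i.succAbove j = k.succAbove j := fun j => by
    have := congr($h j)
    rw [face_apply, face_apply, chain_apply, chain_apply, elt_inj] at this
    have := congrArg Finset.card this
    rw [card_omitted d.2, card_omitted e.2] at this
    omega
  exact Fin.succAbove_left_injective (funext hj)

lemma insert_inj_of_notMem {T : Finset (Fin 7)} {a b : Fin 7} (h : insert a T = insert b T)
    (ha : a ∉ T) : a = b := by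
  have : a ∈ insert b T := h ▸ Finset.mem_insert_self a T
  simpa [ha] using this

lemma insert_pair_cases {T : Finset (Fin 7)} {a b a' b' : Fin 7}
    (h : insert b (insert a T) = insert b' (insert a' T)) (ha : a ∉ T) (hb : b ∉ T) (hab : a ≠ b) :
    (a = a' ∧ b = b') ∨ (a = b' ∧ b = a') := by
  have h1 : a ∈ insert b' (insert a' T) := h ▸ by simp
  have h2 : b ∈ insert b' (insert a' T) := h ▸ by simp
  simp only [Finset.mem_insert, ha, hb, or_false] at h1 h2
  grind

lemma forall_fin_four {P : Fin 4 → Prop} (h0 : P 0) (h1 : P 1) (h2 : P 2) (h3 : P 3) : ∀ i, P i := by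
  intro i; fin_cases i <;> assumption

lemma chain_injective : Function.Injective chain := by
  intro d e h
  have h' : ∀ k, omitted d k = omitted e k := fun k => by
    have := congr($h k)
    rwa [chain_apply, chain_apply, elt_inj] at this
  have h0 := h' 0
  have h1 := h' 1
  have h2 := h' 2
  have h3 := h' 3
  have hd : ∀ i j : Fin 4, i ≠ j → d.1 i ≠ d.1 j := fun i j hij h => hij (d.2.1 h)
  rw [omitted_zero, omitted_zero, ← omitted_one, ← omitted_one, ← h1] at h0
  rw [omitted_one, omitted_one, ← omitted_two, ← omitted_two, ← h2] at h1
  rw [omitted_two, omitted_two] at h2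
  rw [omitted_three, omitted_three, Finset.singleton_inj] at h3
  rw [← h3] at h2
  have e1 := insert_inj_of_notMem h2 (by simp [hd])
  have e2 := insert_inj_of_notMem h1 (by simp [omitted_two, hd])
  have e3 := insert_inj_of_notMem h0 (by simp [omitted_one, hd])
  exact Subtype.ext (funext (forall_fin_four h3 e1 e2 e3))

/-- Four strictly shrinking omitted sets of sizes between 1 and 4 have sizes 4, 3, 2, 1. The tuple
starts with the point omitted throughout and then lists the others as they are added, from the top
of the chain downwards. -/
lemma chain_surjective : Function.Surjective chain := by
  intro x
  choose S hS hx using fun i => exists_elt (x i)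
  have hss : ∀ {i j : Fin 4}, i < j → S j ⊂ S i := fun hij =>
    card_strictAnti x.strictMono S (fun i => ⟨hS i, hx i⟩) hij
  have s01 := hss (show (0 : Fin 4) < 1 by decide)
  have s12 := hss (show (1 : Fin 4) < 2 by decide)
  have s23 := hss (show (2 : Fin 4) < 3 by decide)
  have h0 := card_le_four_of_isGood _ (hS 0)
  have h3 := (hS 3).1.card_pos
  have c01 := Finset.card_lt_card s01
  have c12 := Finset.card_lt_card s12
  have c23 := Finset.card_lt_card s23
  have step : ∀ {A B : Finset (Fin 7)}, A ⊂ B → B.card = A.card + 1 → ∃ a, a ∉ A ∧ insert a A = B := by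
    intro A B hAB hc
    obtain ⟨a, haB, haA⟩ := Finset.exists_of_ssubset hAB
    refine ⟨a, haA, Finset.eq_of_subset_of_card_le (Finset.insert_subset haB hAB.1) ?_⟩
    rw [Finset.card_insert_of_notMem haA, hc]
  obtain ⟨a, ha⟩ := Finset.card_eq_one.1 (show (S 3).card = 1 by omega)
  obtain ⟨b, hb, hb'⟩ := step s23 (by omega)
  obtain ⟨c, hc, hc'⟩ := step s12 (by omega)
  obtain ⟨e, he, he'⟩ := step s01 (by omega)
  rw [← hb', ha] at hc hc'
  rw [← hc'] at he he'
  rw [ha] at hb hb'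
  have o : ∀ k, omitted ![a, b, c, e] k = S k := by
    refine forall_fin_four ?_ ?_ ?_ ?_
    · rw [omitted_zero, ← he']; rfl
    · rw [omitted_one, ← hc']; rfl
    · rw [omitted_two, ← hb']; rfl
    · rw [omitted_three, ha]; rfl
  have hv : Valid ![a, b, c, e] := by
    constructor
    · simp only [Finset.mem_insert, Finset.mem_singleton, not_or] at hb hc he
      intro i j hij
      fin_cases i <;> fin_cases j <;> simp_all
    · intro i hi
      refine (hS 0).2 i (hi.trans ?_)
      rw [← o 0, omitted_zero]
      intro y
      simp only [Finset.mem_image, Finset.mem_univ, true_and, forall_exists_index,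
        Finset.mem_insert, Finset.mem_singleton]
      rintro j rfl
      fin_cases j <;> simp
  refine ⟨⟨_, hv⟩, RelEmbedding.ext fun k => ?_⟩
  change chain _ k = x k
  rw [chain_apply, ← hx k, elt_inj]
  exact o k

/-- Maximal chains of `IR(3, 𝔽₂)` are orderings of complements of bases. -/
noncomputable def chainEquiv : ValidTuple ≃ (Fin 4 ↪o IR 3) :=
  Equiv.ofBijective chain ⟨chain_injective, chain_surjective⟩

/-! ### The cycle condition as alternation and contraction. -/

open Classical in
lemma isCycle_iff_sum_faces (f : (Fin 4 ↪o IR 3) → ℂ) :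
    IsCycle f ↔ ∀ (k : Fin 4) (e : ValidTuple),
      ∑ d : ValidTuple, (if face k (chain d) = face k (chain e) then f (chain d) else 0) = 0 := by
  -- Only the index `k` can produce this face, so all its incidences carry the same sign.
  have key : ∀ (k : Fin 4) (e : ValidTuple),
      ∑ x, f x * ∑ i : Fin 4, (if face i x = face k (chain e) then (-1 : ℂ) ^ (i : ℕ) else 0) =
      (-1) ^ (k : ℕ) *
        ∑ d : ValidTuple, (if face k (chain d) = face k (chain e) then f (chain d) else 0) := by
    intro k e
    rw [← chainEquiv.sum_comp, Finset.mul_sum]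
    refine Finset.sum_congr rfl fun d _ => ?_
    change f (chain d) * ∑ i : Fin 4,
      (if face i (chain d) = face k (chain e) then (-1 : ℂ) ^ (i : ℕ) else 0) = _
    rw [Finset.sum_eq_single k]
    · split_ifs <;> ring
    · intro i _ hi
      exact if_neg fun h => hi (index_eq_of_face_chain_eq h)
    · simp
  constructor
  · intro hf k e
    have h := hf (face k (chain e))
    have h' := key k e
    have h0 : (-1 : ℂ) ^ (k : ℕ) * _ = 0 := h'.symm.trans (by convert! h)
    simpa using h0
  · intro hf t
    by_cases ht : ∃ k e, t = face k (chain e)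
    · obtain ⟨k, e, rfl⟩ := ht
      have h' := key k e
      rw [hf k e, mul_zero] at h'
      convert! h'
    · refine Finset.sum_eq_zero fun x _ => ?_
      obtain ⟨d, rfl⟩ := chain_surjective x
      rw [Finset.sum_eq_zero, mul_zero]
      intro i _
      exact if_neg fun h => ht ⟨i, d, h.symm⟩

lemma valid_comp_perm {d : Fin 4 → Fin 7} (hd : Valid d) (e : Equiv.Perm (Fin 4)) :
    Valid (d ∘ e) := by
  refine ⟨hd.1.comp e.injective, fun i hi => hd.2 i (hi.trans ?_)⟩
  intro y
  simp only [Finset.mem_image, Finset.mem_univ, true_and]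
  rintro ⟨j, rfl⟩
  exact ⟨e j, rfl⟩

/-- Dropping the bottom of the chain, which omits all four points, loses exactly the last entry of
the tuple. -/
lemma face_chain_zero_iff (d e : ValidTuple) :
    face 0 (chain d) = face 0 (chain e) ↔ d.1 = Function.update e.1 3 (d.1 3) := by
  rw [face_chain_eq_iff]
  have hd : ∀ i j : Fin 4, i ≠ j → d.1 i ≠ d.1 j := fun i j hij h => hij (d.2.1 h)
  constructor
  · intro h'
    have h1 := h' 1 (by decide)
    have h2 := h' 2 (by decide)
    have h3 := h' 3 (by decide)
    rw [omitted_one, omitted_one, ← omitted_two, ← omitted_two, ← h2] at h1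
    rw [omitted_two, omitted_two] at h2
    rw [omitted_three, omitted_three, Finset.singleton_inj] at h3
    rw [← h3] at h2
    have e1 := insert_inj_of_notMem h2 (by simp [hd])
    have e2 := insert_inj_of_notMem h1 (by simp [omitted_two, hd])
    exact funext (forall_fin_four h3 e1 e2 (by simp))
  · intro h
    have g0 : d.1 0 = e.1 0 := by rw [h]; rfl
    have g1 : d.1 1 = e.1 1 := by rw [h]; rfl
    have g2 : d.1 2 = e.1 2 := by rw [h]; rfl
    refine forall_fin_four (by simp) ?_ ?_ ?_ <;> intro _ <;>
      simp [omitted_one, omitted_two, omitted_three, g0, g1, g2]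

lemma eq_comp_swap_iff (d e : Fin 4 → Fin 7) (a b : Fin 4) :
    d = e ∘ Equiv.swap a b ↔ d a = e b ∧ d b = e a ∧ ∀ i, i ≠ a → i ≠ b → d i = e i := by
  rw [funext_iff]
  constructor
  · intro h
    refine ⟨by simp [h a], by simp [h b], fun i ha hb => ?_⟩
    rw [h i, Function.comp_apply, Equiv.swap_apply_of_ne_of_ne ha hb]
  · rintro ⟨h1, h2, h3⟩ i
    by_cases ha : i = a
    · subst ha; simp [h1]
    by_cases hb : i = b
    · subst hb; simp [h2]
    rw [h3 i ha hb, Function.comp_apply, Equiv.swap_apply_of_ne_of_ne ha hb]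

/-- The index `j.rev.succ` is 3 - j. Dropping that element of the chain loses only the order of the
entries j and j + 1. -/
lemma face_chain_succ_iff (j : Fin 3) (d e : ValidTuple) :
    face j.rev.succ (chain d) = face j.rev.succ (chain e) ↔
      d.1 = e.1 ∨ d.1 = e.1 ∘ Equiv.swap j.castSucc j.succ := by
  rw [face_chain_eq_iff, eq_comp_swap_iff]
  have hd : ∀ i j : Fin 4, i ≠ j → d.1 i ≠ d.1 j := fun i j hij h => hij (d.2.1 h)
  have hne : ∀ i j : Fin 4, i ≠ j → e.1 i ≠ e.1 j := fun i j hij h => hij (e.2.1 h)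
  constructor
  · intro h'
    fin_cases j
    · have h0 := h' 0 (by decide)
      have h1 := h' 1 (by decide)
      have h2 := h' 2 (by decide)
      rw [omitted_zero, omitted_zero, ← omitted_one, ← omitted_one, ← h1] at h0
      rw [omitted_one, omitted_one, ← omitted_two, ← omitted_two, ← h2] at h1
      rw [omitted_two, omitted_two, ← insert_empty_eq, ← insert_empty_eq (e.1 0)] at h2
      have e3 := insert_inj_of_notMem h0 (by simp [omitted_one, hd])
      have e2 := insert_inj_of_notMem h1 (by simp [omitted_two, hd])
      rcases insert_pair_cases h2 (by simp) (by simp) (hd _ _ (by decide)) with ⟨p, q⟩ | ⟨p, q⟩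
      · exact Or.inl (funext (forall_fin_four p q e2 e3))
      · refine Or.inr ⟨p, q, forall_fin_four ?_ ?_ ?_ ?_⟩ <;> simp [e2, e3]
    · have h0 := h' 0 (by decide)
      have h1 := h' 1 (by decide)
      have h3 := h' 3 (by decide)
      rw [omitted_zero, omitted_zero, ← omitted_one, ← omitted_one, ← h1] at h0
      rw [omitted_three, omitted_three, Finset.singleton_inj] at h3
      rw [omitted_one, omitted_one, ← h3] at h1
      have e3 := insert_inj_of_notMem h0 (by simp [omitted_one, hd])
      rcases insert_pair_cases h1 (by simp [hd]) (by simp [hd]) (hd _ _ (by decide)) with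
        ⟨p, q⟩ | ⟨p, q⟩
      · exact Or.inl (funext (forall_fin_four h3 p q e3))
      · refine Or.inr ⟨p, q, forall_fin_four ?_ ?_ ?_ ?_⟩ <;> simp [h3, e3]
    · have h0 := h' 0 (by decide)
      have h2 := h' 2 (by decide)
      have h3 := h' 3 (by decide)
      rw [omitted_zero, omitted_zero, ← omitted_two, ← omitted_two, ← h2] at h0
      rw [omitted_three, omitted_three, Finset.singleton_inj] at h3
      rw [omitted_two, omitted_two, ← h3] at h2
      have e1 := insert_inj_of_notMem h2 (by simp [hd])
      rcases insert_pair_cases h0 (by simp [omitted_two, hd]) (by simp [omitted_two, hd])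
        (hd _ _ (by decide)) with ⟨p, q⟩ | ⟨p, q⟩
      · exact Or.inl (funext (forall_fin_four h3 e1 p q))
      · refine Or.inr ⟨p, q, forall_fin_four ?_ ?_ ?_ ?_⟩ <;> simp [h3, e1]
  · rintro (h | ⟨p, q, h⟩)
    · intro l _
      rw [h]
    · fin_cases j
      · have p : d.1 0 = e.1 1 := p
        have q : d.1 1 = e.1 0 := q
        have r2 : d.1 2 = e.1 2 := h 2 (by decide) (by decide)
        have r3 : d.1 3 = e.1 3 := h 3 (by decide) (by decide)
        refine forall_fin_four ?_ ?_ ?_ fun h => absurd rfl h <;> intro _ <;>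
          simp [omitted_zero, omitted_one, omitted_two, p, q, r2, r3, Finset.pair_comm]
      · have p : d.1 1 = e.1 2 := p
        have q : d.1 2 = e.1 1 := q
        have r0 : d.1 0 = e.1 0 := h 0 (by decide) (by decide)
        have r3 : d.1 3 = e.1 3 := h 3 (by decide) (by decide)
        refine forall_fin_four ?_ ?_ (fun h => absurd rfl h) ?_ <;> intro _ <;>
          simp [omitted_zero, omitted_one, omitted_three, p, q, r0, r3,
            Finset.insert_comm (e.1 1) (e.1 2)]
      · have p : d.1 2 = e.1 3 := p
        have q : d.1 3 = e.1 2 := q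
        have r0 : d.1 0 = e.1 0 := h 0 (by decide) (by decide)
        have r1 : d.1 1 = e.1 1 := h 1 (by decide) (by decide)
        refine forall_fin_four ?_ (fun h => absurd rfl h) ?_ ?_ <;> intro _ <;>
          simp [omitted_zero, omitted_two, omitted_three, p, q, r0, r1,
            Finset.insert_comm (e.1 2) (e.1 3)]

/-- Alternating functions on quadruples of points of the Fano plane which vanish on complements of
lines and whose contraction with the constant function is zero. -/
def tupleCycles : Submodule ℂ ((Fin 4 → Fin 7) → ℂ) where
  carrier := {F | (∀ d, ¬ Valid d → F d = 0) ∧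
    (∀ d (j : Fin 3), F (d ∘ Equiv.swap j.castSucc j.succ) = -F d) ∧
    ∀ d, ∑ y, F (Function.update d 3 y) = 0}
  add_mem' := by
    rintro F F' ⟨h1, h2, h3⟩ ⟨h1', h2', h3'⟩
    refine ⟨fun d hd => ?_, fun d j => ?_, fun d => ?_⟩
    · simp [h1 d hd, h1' d hd]
    · simp only [Pi.add_apply, h2, h2']; ring
    · simp only [Pi.add_apply, Finset.sum_add_distrib, h3, h3', add_zero]
  zero_mem' := by simp
  smul_mem' := by
    rintro c F ⟨h1, h2, h3⟩
    refine ⟨fun d hd => ?_, fun d j => ?_, fun d => ?_⟩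
    · simp [h1 d hd]
    · simp [h2]
    · simp [← Finset.mul_sum, h3]

lemma sum_validTuple {F : (Fin 4 → Fin 7) → ℂ} (hF : ∀ d, ¬ Valid d → F d = 0)
    (p : (Fin 4 → Fin 7) → Prop) [DecidablePred p] :
    ∑ d : ValidTuple, (if p d.1 then F d.1 else 0) = ∑ d, if p d then F d else 0 := by
  refine Finset.sum_of_injOn Subtype.val Subtype.val_injective.injOn (by simp) ?_ (by simp)
  intro d _ hd
  rw [hF d, ite_self]
  intro h
  exact hd ⟨⟨d, h⟩, by simp, rfl⟩

open Classical in
lemma sum_face_zero {F : (Fin 4 → Fin 7) → ℂ} (hF : ∀ d, ¬ Valid d → F d = 0) (e : ValidTuple) :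
    ∑ d : ValidTuple, (if face 0 (chain d) = face 0 (chain e) then F d.1 else 0) =
      ∑ y, F (Function.update e.1 3 y) := by
  simp only [face_chain_zero_iff]
  rw [sum_validTuple hF fun d => d = Function.update e.1 3 (d 3)]
  have hinj : Function.Injective fun y => Function.update e.1 3 y := Function.update_injective e.1 3
  symm
  refine Finset.sum_of_injOn _ hinj.injOn (by simp) ?_ (by simp)
  intro d _ hd
  refine if_neg fun h => hd ?_
  exact ⟨d 3, by simp, h.symm⟩

open Classical in
lemma sum_face_succ {F : (Fin 4 → Fin 7) → ℂ} (hF : ∀ d, ¬ Valid d → F d = 0) (j : Fin 3)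
    (e : ValidTuple) :
    ∑ d : ValidTuple,
      (if face j.rev.succ (chain d) = face j.rev.succ (chain e) then F d.1 else 0) =
      F e.1 + F (e.1 ∘ Equiv.swap j.castSucc j.succ) := by
  simp only [face_chain_succ_iff]
  rw [sum_validTuple hF fun d => d = e.1 ∨ d = e.1 ∘ Equiv.swap j.castSucc j.succ]
  have hne : e.1 ≠ e.1 ∘ Equiv.swap j.castSucc j.succ := fun h => by
    have := e.2.1 (congrFun h j.castSucc)
    simp [Fin.ext_iff] at this
  rw [← Finset.sum_filter, ← Finset.sum_pair hne]
  congr 1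
  ext d
  simp

/-- The coefficients of a homology class of degree three at the orderings of complements of
bases. -/
noncomputable def tupleCoeff : homologyIR 3 3 →ₗ[ℂ] ((Fin 4 → Fin 7) → ℂ) :=
  LinearMap.pi fun d =>
    if h : Valid d then LinearMap.proj (chain ⟨d, h⟩) ∘ₗ topCoeff no_long_chain else 0

lemma tupleCoeff_of_valid (z : homologyIR 3 3) (d : ValidTuple) :
    tupleCoeff z d.1 = topCoeff no_long_chain z (chain d) := by
  rw [tupleCoeff, LinearMap.pi_apply, dif_pos d.2]
  rfl

lemma tupleCoeff_of_not_valid (z : homologyIR 3 3) {d : Fin 4 → Fin 7} (hd : ¬ Valid d) :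
    tupleCoeff z d = 0 := by
  rw [tupleCoeff, LinearMap.pi_apply, dif_neg hd]
  rfl

lemma tupleCoeff_injective : Function.Injective tupleCoeff := by
  intro z w h
  refine topCoeff_injective no_long_chain (funext fun x => ?_)
  obtain ⟨d, rfl⟩ := chain_surjective x
  rw [← tupleCoeff_of_valid, ← tupleCoeff_of_valid, h]

/-- A face of nonzero index lies in two maximal chains, differing by an adjacent transposition, so
those faces express alternation. Face 0 leaves the last entry free and gives the vanishing sum. -/
lemma isCycle_iff_mem_tupleCycles {f : (Fin 4 ↪o IR 3) → ℂ} {F : (Fin 4 → Fin 7) → ℂ}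
    (hF : ∀ d, ¬ Valid d → F d = 0) (hf : ∀ d : ValidTuple, f (chain d) = F d.1) :
    IsCycle f ↔ F ∈ tupleCycles := by
  classical
  rw [isCycle_iff_sum_faces]
  simp only [hf]
  constructor
  · intro h
    refine ⟨hF, fun d j => ?_, fun d => ?_⟩
    · by_cases hd : Valid d
      · have h1 := h j.rev.succ ⟨d, hd⟩
        have h2 := sum_face_succ hF j ⟨d, hd⟩
        have h3 : F d + F (d ∘ Equiv.swap j.castSucc j.succ) = 0 :=
          h2.symm.trans (by convert! h1)
        exact eq_neg_of_add_eq_zero_right h3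
      · rw [hF d hd, hF, neg_zero]
        intro h
        apply hd
        have := valid_comp_perm h (Equiv.swap j.castSucc j.succ)
        rwa [Function.comp_assoc, ← Equiv.coe_trans, Equiv.swap_swap] at this
    · by_cases hd : ∃ y, Valid (Function.update d 3 y)
      · obtain ⟨y, hy⟩ := hd
        have h1 := h 0 ⟨_, hy⟩
        have h2 := sum_face_zero hF ⟨_, hy⟩
        simp only [Function.update_idem] at h2
        exact h2.symm.trans (by convert! h1)
      · exact Finset.sum_eq_zero fun y _ => hF _ fun h => hd ⟨y, h⟩
  · rintro ⟨-, h2, h3⟩ k e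
    obtain rfl | ⟨j, rfl⟩ : k = 0 ∨ ∃ j : Fin 3, k = j.rev.succ := by
      rcases Fin.eq_zero_or_eq_succ k with h | ⟨j, rfl⟩
      · exact Or.inl h
      · exact Or.inr ⟨j.rev, by simp⟩
    · have := sum_face_zero hF e
      rw [h3] at this
      convert! this
    · have := sum_face_succ hF j e
      rw [h2, add_neg_cancel] at this
      convert! this

lemma tupleCoeff_mem (z : homologyIR 3 3) : tupleCoeff z ∈ tupleCycles :=
  (isCycle_iff_mem_tupleCycles (fun _ hd => tupleCoeff_of_not_valid z hd)
    fun d => (tupleCoeff_of_valid z d).symm).1 (isCycle_topCoeff no_long_chain z)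

lemma exists_tupleCoeff_eq {F : (Fin 4 → Fin 7) → ℂ} (hF : F ∈ tupleCycles) :
    ∃ z, tupleCoeff z = F := by
  have hf : IsCycle fun x => F (chainEquiv.symm x).1 :=
    (isCycle_iff_mem_tupleCycles hF.1 fun d => by
      change F (chainEquiv.symm (chainEquiv d)).1 = _
      rw [Equiv.symm_apply_apply]).2 hF
  obtain ⟨z, hz⟩ := exists_topCoeff_eq no_long_chain hf
  refine ⟨z, funext fun d => ?_⟩
  by_cases hd : Valid d
  · rw [tupleCoeff_of_valid z ⟨d, hd⟩, hz]
    change F (chainEquiv.symm (chainEquiv _)).1 = _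
    rw [Equiv.symm_apply_apply]
  · rw [tupleCoeff_of_not_valid z hd, hF.1 d hd]

/-- The third homology of `IR(3, 𝔽₂)` in terms of functions on quadruples. -/
noncomputable def tupleEquiv : homologyIR 3 3 ≃ₗ[ℂ] tupleCycles :=
  LinearEquiv.ofBijective (tupleCoeff.codRestrict tupleCycles tupleCoeff_mem)
    ⟨fun _ _ h => tupleCoeff_injective congr(($h).1),
      fun F => (exists_tupleCoeff_eq F.2).imp fun _ h => Subtype.ext h⟩

lemma coe_tupleEquiv (z : homologyIR 3 3) : (tupleEquiv z).1 = tupleCoeff z := rfl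

/-! ### The group action on functions of quadruples. -/

lemma smul_elt {g : Matrix.SpecialLinearGroup (Fin 3) (ZMod 2)} {π : Equiv.Perm (Fin 7)}
    (hπ : ∀ i, (g : Matrix _ _ (ZMod 2)).mulVec (pt i) = pt (π i)) {S T : Finset (Fin 7)}
    {hS : IsGood S} {hT : IsGood T} (h : ∀ i, π i ∈ T ↔ i ∈ S) :
    g • elt S hS = elt T hT := by
  refine Subtype.ext ?_
  rw [coe_smul]
  ext v
  constructor
  · rintro ⟨_, ⟨i, hi, rfl⟩, rfl⟩
    exact ⟨π i, fun h' => hi ((h i).1 h'), (hπ i).symm⟩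
  · rintro ⟨i, hi, rfl⟩
    refine ⟨_, ⟨π.symm i, fun h' => hi ?_, rfl⟩, ?_⟩
    · simpa using (h _).2 h'
    · change (g : Matrix (Fin 3) (Fin 3) (ZMod 2)).mulVec _ = _
      rw [hπ, Equiv.apply_symm_apply]

/-- Permutations induced by `SL(3, 𝔽₂)` preserve complements of bases. -/
lemma valid_perm_comp_iff {g : Matrix.SpecialLinearGroup (Fin 3) (ZMod 2)} {π : Equiv.Perm (Fin 7)}
    (hπ : ∀ i, (g : Matrix _ _ (ZMod 2)).mulVec (pt i) = pt (π i)) {d : Fin 4 → Fin 7}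
    (hd : Valid d) : Valid (π ∘ d) := by
  refine ⟨π.injective.comp hd.1, ?_⟩
  -- The action on `IR 3` already preserves regularity and rank, so goodness of the image needs no
  -- inspection of lines.
  have hg : IsGood (Finset.univ.image d) := ⟨⟨d 0, by simp⟩, hd.2⟩
  have h1 := (g • elt _ hg).2
  obtain ⟨S, hS, he⟩ := exists_elt (g • elt _ hg)
  have h2 : S = Finset.univ.image (π ∘ d) := by
    ext i
    have h3 : pt i ∈ (g • elt _ hg).1 ↔ i ∉ S := by rw [← he]; exact pt_mem_comp
    have h4 : pt i ∈ (g • elt _ hg).1 ↔ π.symm i ∉ Finset.univ.image d := by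
      rw [coe_smul]
      constructor
      · rintro ⟨_, ⟨k, hk, rfl⟩, h⟩
        have h : (g : Matrix _ _ (ZMod 2)).mulVec (pt k) = pt i := h
        rw [hπ] at h
        rwa [← pt_injective h, Equiv.symm_apply_apply]
      · intro h
        refine ⟨_, ⟨_, h, rfl⟩, ?_⟩
        change (g : Matrix (Fin 3) (Fin 3) (ZMod 2)).mulVec _ = _
        rw [hπ, Equiv.apply_symm_apply]
    rw [h3, not_iff_not] at h4
    rw [h4]
    simp [Equiv.eq_symm_apply]
  exact h2 ▸ hS.2

/-- The action of `SL(3, 𝔽₂)` on homology in terms of functions on quadruples. -/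
lemma tupleCoeff_homologyRep {g : Matrix.SpecialLinearGroup (Fin 3) (ZMod 2)}
    {π : Equiv.Perm (Fin 7)} (hπ : ∀ i, (g : Matrix _ _ (ZMod 2)).mulVec (pt i) = pt (π i))
    (z : homologyIR 3 3) (d : Fin 4 → Fin 7) :
    tupleCoeff (homologyRep 3 3 g z) (π ∘ d) = tupleCoeff z d := by
  by_cases hd : Valid d
  · have hd' := valid_perm_comp_iff hπ hd
    rw [tupleCoeff_of_valid _ ⟨_, hd'⟩, tupleCoeff_of_valid _ ⟨_, hd⟩]
    refine topCoeff_map no_long_chain (smul_mono g) (MulAction.injective g) z _ _ fun k => ?_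
    rw [chain_apply, chain_apply]
    refine (smul_elt hπ fun i => ?_).symm
    simp [omitted]
  · have hd' : ¬ Valid (π ∘ d) := by
      intro h
      have hg : ∀ i, ((g⁻¹ : Matrix.SpecialLinearGroup (Fin 3) (ZMod 2)) :
          Matrix _ _ (ZMod 2)).mulVec (pt i) = pt (π.symm i) := by
        intro i
        obtain ⟨k, rfl⟩ := π.surjective i
        rw [← hπ, Matrix.mulVec_mulVec, ← Matrix.SpecialLinearGroup.coe_mul, inv_mul_cancel]
        simp
      have := valid_perm_comp_iff hg h
      rw [← Function.comp_assoc, ← Equiv.coe_trans, Equiv.self_trans_symm] at this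
      exact hd this
    rw [tupleCoeff_of_not_valid _ hd', tupleCoeff_of_not_valid _ hd]

/-! ### Eight values determine a cycle. -/

section Alternating

variable {F : (Fin 4 → Fin 7) → ℂ}
  (hF : ∀ d (j : Fin 3), F (d ∘ Equiv.swap j.castSucc j.succ) = -F d)
include hF

/-- Adjacent transpositions generate the symmetric group. -/
lemma alternating_perm (d : Fin 4 → Fin 7) (e : Equiv.Perm (Fin 4)) :
    F (d ∘ e) = ((Equiv.Perm.sign e : ℤ) : ℂ) * F d := by
  have he : e ∈ Submonoid.closure
      (Set.range fun i : Fin 3 => Equiv.swap i.castSucc i.succ) := by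
    rw [Equiv.Perm.mclosure_swap_castSucc_succ]; trivial
  induction he using Submonoid.closure_induction generalizing d with
  | mem x hx =>
    obtain ⟨j, rfl⟩ := hx
    rw [hF, Equiv.Perm.sign_swap (by simp [Fin.ext_iff])]
    simp
  | one => simp
  | mul x y _ _ hx hy =>
    rw [Equiv.Perm.coe_mul, ← Function.comp_assoc, hy, hx, map_mul]
    push_cast
    ring

lemma alternating_of_not_injective {d : Fin 4 → Fin 7} (hd : ¬ Function.Injective d) :
    F d = 0 := by
  rw [Function.not_injective_iff] at hd
  obtain ⟨i, j, hij, hne⟩ := hd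
  have h1 := alternating_perm hF d (Equiv.swap i j)
  have h2 : d ∘ Equiv.swap i j = d := by
    funext k
    by_cases hi : k = i
    · subst hi; simp [hij]
    by_cases hj : k = j
    · subst hj; simp [hij]
    · simp [Equiv.swap_apply_of_ne_of_ne hi hj]
  rw [h2, Equiv.Perm.sign_swap hne] at h1
  simp only [Units.val_neg, Units.val_one, Int.cast_neg, Int.cast_one, neg_mul, one_mul] at h1
  exact self_eq_neg.1 h1

/-- Whether an alternating function vanishes at a tuple depends only on the image. -/
lemma alternating_eq_zero_of_image_eq {d e : Fin 4 → Fin 7}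
    (h : Finset.univ.image e = Finset.univ.image d) (hd : F d = 0) : F e = 0 := by
  by_cases he : Function.Injective e
  · have hd' : Function.Injective d := by
      rw [← Set.injOn_univ, ← Finset.coe_univ, ← Finset.card_image_iff, ← h,
        Finset.card_image_of_injective _ he]
    have hr : Set.range e = Set.range d := by
      have := congrArg (fun S : Finset (Fin 7) => (S : Set (Fin 7))) h
      simpa using this
    let π : Equiv.Perm (Fin 4) := (Equiv.ofInjective e he).trans
      ((Equiv.setCongr hr).trans (Equiv.ofInjective d hd').symm)
    have hπ : e = d ∘ π := by
      funext i
      have := Equiv.apply_ofInjective_symm hd' ((Equiv.setCongr hr) (Equiv.ofInjective e he i))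
      exact this.symm
    rw [hπ, alternating_perm hF, hd, mul_zero]
  · exact alternating_of_not_injective hF he

end Alternating

/-- The function vanishes at all orderings of the given set. -/
def VanishesOn (F : (Fin 4 → Fin 7) → ℂ) (S : Finset (Fin 7)) : Prop :=
  ∀ d, Finset.univ.image d = S → F d = 0

/-- In the cycle condition at the triple `T`, terms with a repeated point vanish by alternation,
which leaves the term at `x` alone. -/
lemma vanishesOn_insert {F : (Fin 4 → Fin 7) → ℂ} (hF : F ∈ tupleCycles) {T : Finset (Fin 7)}
    (hT : T.card = 3) {x : Fin 7} (h : ∀ y, y ∉ T → y ≠ x → VanishesOn F (insert y T)) :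
    VanishesOn F (insert x T) := by
  obtain ⟨a, b, c, hab, hac, hbc, rfl⟩ := Finset.card_eq_three.1 hT
  have himg : ∀ y, Finset.univ.image ![a, b, c, y] = insert y {a, b, c} := by
    intro y
    ext z
    simp [Fin.exists_fin_succ, eq_comm]
    tauto
  have hup : ∀ y, Function.update ![a, b, c, x] 3 y = ![a, b, c, y] := by
    intro y; ext i; fin_cases i <;> rfl
  have hsum := hF.2.2 ![a, b, c, x]
  simp only [hup] at hsum
  rw [Finset.sum_eq_single x] at hsum
  · intro d hd
    exact alternating_eq_zero_of_image_eq hF.2.1 (hd.trans (himg x).symm) hsum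
  · intro y _ hy
    by_cases hyT : y ∈ ({a, b, c} : Finset (Fin 7))
    · refine alternating_of_not_injective hF.2.1 fun hinj => ?_
      have h1 := himg y
      rw [Finset.insert_eq_of_mem hyT] at h1
      have h2 := congrArg Finset.card h1
      rw [Finset.card_image_of_injective _ hinj, hT] at h2
      simp at h2
    · exact h y hyT hy _ (himg y)
  · simp

/-- Eight quadruples whose values determine a cycle. -/
def coordTuple : Fin 8 → Fin 4 → Fin 7 :=
  ![![0, 1, 2, 3], ![1, 2, 3, 4], ![3, 0, 4, 1], ![0, 4, 1, 5], ![1, 3, 5, 0], ![3, 5, 0, 2],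
    ![5, 0, 2, 4], ![2, 3, 4, 5]]

-- The fifteen quadruples avoiding point 6 are three complements of lines, eight coordinates, and
-- four that are eliminated next.
set_option maxRecDepth 20000 in
lemma card_four_cases : ∀ S : Finset (Fin 7), 6 ∉ S → S.card = 4 →
    (∃ i, lineCompl i = S) ∨ (∃ i, Finset.univ.image (coordTuple i) = S) ∨
      S = {4, 0, 3, 5} ∨ S = {2, 0, 1, 4} ∨ S = {5, 1, 2, 3} ∨ S = {1, 2, 4, 5} := by
  decide

lemma eq_zero_of_coordTuple {F : (Fin 4 → Fin 7) → ℂ} (hF : F ∈ tupleCycles)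
    (h : ∀ i, F (coordTuple i) = 0) : F = 0 := by
  have hline : ∀ i, VanishesOn F (lineCompl i) := fun i d hd =>
    hF.1 d fun hv => hv.2 i hd.ge
  have hcoord : ∀ i, VanishesOn F (Finset.univ.image (coordTuple i)) := fun i d hd =>
    alternating_eq_zero_of_image_eq hF.2.1 hd (h i)
  have haux : ∀ (T : Finset (Fin 7)) (x : Fin 7), T.card = 3 →
      (∀ y, y ∉ T → y ≠ x → (∃ i, lineCompl i = insert y T) ∨
        ∃ i, Finset.univ.image (coordTuple i) = insert y T) → VanishesOn F (insert x T) := by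
    intro T x hT hy
    refine vanishesOn_insert hF hT fun y hyT hyx => ?_
    rcases hy y hyT hyx with ⟨i, hi⟩ | ⟨i, hi⟩
    · exact hi ▸ hline i
    · exact hi ▸ hcoord i
  have h6 : ∀ S : Finset (Fin 7), 6 ∉ S → S.card = 4 → VanishesOn F S := by
    intro S hS hc
    rcases card_four_cases S hS hc with ⟨i, rfl⟩ | ⟨i, rfl⟩ | rfl | rfl | rfl | rfl
    · exact hline i
    · exact hcoord i
    -- In these four cases the triple together with 6 is a line complement, so the cycle condition
    -- involves only one unknown value.
    · exact haux {0, 3, 5} 4 (by decide) (by decide)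
    · exact haux {0, 1, 4} 2 (by decide) (by decide)
    · exact haux {1, 2, 3} 5 (by decide) (by decide)
    · exact haux {2, 4, 5} 1 (by decide) (by decide)
  have hall : ∀ S : Finset (Fin 7), S.card = 4 → VanishesOn F S := by
    intro S hc
    by_cases hS : 6 ∈ S
    · rw [← Finset.insert_erase hS]
      have hT : (S.erase 6).card = 3 := by rw [Finset.card_erase_of_mem hS, hc]
      refine vanishesOn_insert hF hT fun y hy hy6 => h6 _ ?_ ?_
      · simp [Ne.symm hy6]
      · rw [Finset.card_insert_of_notMem hy, hT]
    · exact h6 S hS hc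
  funext d
  by_cases hd : Function.Injective d
  · exact hall _ (by rw [Finset.card_image_of_injective _ hd]; simp) d rfl
  · exact alternating_of_not_injective hF.2.1 hd

/-! ### The normalizer of the Singer cycle and its eight cosets. -/

open Matrix in
/-- An element of order `3` in `SL(3, 𝔽₂)` normalizing the Singer cycle. -/
def frob : Matrix.SpecialLinearGroup (Fin 3) (ZMod 2) :=
  ⟨!![1, 0, 0; 0, 0, 1; 0, 1, 1], by decide⟩

open Matrix in
/-- An involution in `SL(3, 𝔽₂)` not normalizing the Singer cycle. -/
def invol : Matrix.SpecialLinearGroup (Fin 3) (ZMod 2) :=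
  ⟨!![0, 1, 0; 1, 0, 0; 0, 0, 1], by decide⟩

/-- Representatives of the cosets of the normalizer of the Singer cycle. -/
def cosetRep (i : Fin 8) : Matrix.SpecialLinearGroup (Fin 3) (ZMod 2) :=
  Fin.cases 1 (fun j : Fin 7 => singer ^ (j : ℕ) * invol) i

/-- The inverse of the permutation of the points induced by `cosetRep`. -/
def cosetRepInv (i : Fin 8) : Fin 7 → Fin 7 :=
  Fin.cases id (fun j : Fin 7 => fun x => ![1, 0, 2, 3, 6, 5, 4] (x - j)) i

/-! ### Explicit cycles from Pfaffians. -/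

/-- The alternating circulant form with `ε(a, a + k) = 1`. -/
def circ (k a b : Fin 7) : ℤ := (if b = a + k then 1 else 0) - (if a = b + k then 1 else 0)

lemma circ_swap (k a b : Fin 7) : circ k b a = -circ k a b := by
  unfold circ; ring

/-- The neighbours `a + k` and `a - k` contribute opposite signs. Since the Pfaffian is linear in
each row, this makes its contraction with the constant function zero. -/
lemma sum_circ : ∀ k a : Fin 7, ∑ b, circ k a b = 0 := by decide

/-- The Pfaffian of the circulant form: the fundamental cycle of the boundary of a cyclic
polytope. -/
def pf (k : Fin 7) (d : Fin 4 → Fin 7) : ℤ :=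
  circ k (d 0) (d 1) * circ k (d 2) (d 3) - circ k (d 0) (d 2) * circ k (d 1) (d 3) +
    circ k (d 0) (d 3) * circ k (d 1) (d 2)

lemma pf_swap (k : Fin 7) (d : Fin 4 → Fin 7) (j : Fin 3) :
    pf k (d ∘ Equiv.swap j.castSucc j.succ) = -pf k d := by
  unfold pf
  fin_cases j
  · have h0 : Equiv.swap (0 : Fin 4) 1 0 = 1 := by decide
    have h1 : Equiv.swap (0 : Fin 4) 1 1 = 0 := by decide
    have h2 : Equiv.swap (0 : Fin 4) 1 2 = 2 := by decide
    have h3 : Equiv.swap (0 : Fin 4) 1 3 = 3 := by decide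
    simp only [Fin.zero_eta, Fin.castSucc_zero, Fin.succ_zero_eq_one, Function.comp_apply,
      h0, h1, h2, h3]
    rw [circ_swap k (d 0) (d 1)]
    ring
  · have h0 : Equiv.swap (1 : Fin 4) 2 0 = 0 := by decide
    have h1 : Equiv.swap (1 : Fin 4) 2 1 = 2 := by decide
    have h2 : Equiv.swap (1 : Fin 4) 2 2 = 1 := by decide
    have h3 : Equiv.swap (1 : Fin 4) 2 3 = 3 := by decide
    change circ k (d (Equiv.swap (1 : Fin 4) 2 0)) (d (Equiv.swap (1 : Fin 4) 2 1)) *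
      circ k (d (Equiv.swap (1 : Fin 4) 2 2)) (d (Equiv.swap (1 : Fin 4) 2 3)) -
      circ k (d (Equiv.swap (1 : Fin 4) 2 0)) (d (Equiv.swap (1 : Fin 4) 2 2)) *
      circ k (d (Equiv.swap (1 : Fin 4) 2 1)) (d (Equiv.swap (1 : Fin 4) 2 3)) +
      circ k (d (Equiv.swap (1 : Fin 4) 2 0)) (d (Equiv.swap (1 : Fin 4) 2 3)) *
      circ k (d (Equiv.swap (1 : Fin 4) 2 1)) (d (Equiv.swap (1 : Fin 4) 2 2)) = _
    rw [h0, h1, h2, h3, circ_swap k (d 1) (d 2)]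
    ring
  · have h0 : Equiv.swap (2 : Fin 4) 3 0 = 0 := by decide
    have h1 : Equiv.swap (2 : Fin 4) 3 1 = 1 := by decide
    have h2 : Equiv.swap (2 : Fin 4) 3 2 = 3 := by decide
    have h3 : Equiv.swap (2 : Fin 4) 3 3 = 2 := by decide
    change circ k (d (Equiv.swap (2 : Fin 4) 3 0)) (d (Equiv.swap (2 : Fin 4) 3 1)) *
      circ k (d (Equiv.swap (2 : Fin 4) 3 2)) (d (Equiv.swap (2 : Fin 4) 3 3)) -
      circ k (d (Equiv.swap (2 : Fin 4) 3 0)) (d (Equiv.swap (2 : Fin 4) 3 2)) *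
      circ k (d (Equiv.swap (2 : Fin 4) 3 1)) (d (Equiv.swap (2 : Fin 4) 3 3)) +
      circ k (d (Equiv.swap (2 : Fin 4) 3 0)) (d (Equiv.swap (2 : Fin 4) 3 3)) *
      circ k (d (Equiv.swap (2 : Fin 4) 3 1)) (d (Equiv.swap (2 : Fin 4) 3 2)) = _
    rw [h0, h1, h2, h3, circ_swap k (d 2) (d 3)]
    ring

/-- For `k ≠ 0`, the pairs with difference `±k` inside a line complement form a path on three points
and leave the fourth isolated. There is no perfect matching, so every term of the Pfaffian vanishes;
for `k = 0` the form itself is zero. -/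
lemma pf_lineCompl : ∀ i k : Fin 7, pf k ![i + 2, i + 4, i + 5, i + 6] = 0 := by decide

lemma pf_mem (k : Fin 7) : (fun d => (pf k d : ℂ)) ∈ tupleCycles := by
  have halt : ∀ d (j : Fin 3), (pf k (d ∘ Equiv.swap j.castSucc j.succ) : ℂ) = -pf k d :=
    fun d j => by rw [pf_swap]; push_cast; ring
  refine ⟨fun d hd => ?_, halt, fun d => ?_⟩
  · by_cases hinj : Function.Injective d
    · have hd : ∃ i, lineCompl i ⊆ Finset.univ.image d := by
        by_contra! h
        exact hd ⟨hinj, h⟩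
      obtain ⟨i, hi⟩ := hd
      have hc : ∀ i, (lineCompl i).card = 4 := by decide
      have him : ∀ i : Fin 7, Finset.univ.image ![i + 2, i + 4, i + 5, i + 6] = lineCompl i := by
        decide
      have h := Finset.eq_of_subset_of_card_le hi
        (by rw [hc, Finset.card_image_of_injective _ hinj]; simp)
      exact alternating_eq_zero_of_image_eq (F := fun d => (pf k d : ℂ)) halt 
        (h.symm.trans (him i).symm) (by simp only [pf_lineCompl, Int.cast_zero])
    · exact alternating_of_not_injective (F := fun d => (pf k d : ℂ)) halt hinj
  · have h0 : ∀ y, Function.update d 3 y 0 = d 0 := fun y => rfl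
    have h1 : ∀ y, Function.update d 3 y 1 = d 1 := fun y => rfl
    have h2 : ∀ y, Function.update d 3 y 2 = d 2 := fun y => rfl
    have h3 : ∀ y, Function.update d 3 y 3 = y := fun y => by simp
    have : ∑ y, pf k (Function.update d 3 y) = 0 := by
      simp only [pf, h0, h1, h2, h3, Finset.sum_add_distrib, Finset.sum_sub_distrib,
        ← Finset.mul_sum, ← Finset.sum_mul, sum_circ]
      simp
    simpa using congrArg (Int.cast : ℤ → ℂ) this

lemma pf_shift (k : Fin 7) (d : Fin 4 → Fin 7) : pf k (fun i => d i + 1) = pf k d := by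
  have : ∀ k a b, circ k (a + 1) (b + 1) = circ k a b := by decide
  simp only [pf, this]

/-- Doubling permutes the Pfaffians for k = 1, 2, 4 cyclically, whence the weights 1, ω², ω of the
eigenvector. -/
lemma pf_double (k : Fin 7) (d : Fin 4 → Fin 7) : pf (2 * k) (fun i => 2 * d i) = pf k d := by
  have : ∀ k a b, circ (2 * k) (2 * a) (2 * b) = circ k a b := by decide
  simp only [pf, this]

/-- An eigenvector of the normalizer of the Singer cycle. -/
noncomputable def eigenTuple (ω : ℂ) (d : Fin 4 → Fin 7) : ℂ := pf 1 d + ω ^ 2 * pf 2 d + ω * pf 4 d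

lemma eigenTuple_mem (ω : ℂ) : eigenTuple ω ∈ tupleCycles :=
  add_mem (add_mem (pf_mem 1) (Submodule.smul_mem _ (ω ^ 2) (pf_mem 2)))
    (Submodule.smul_mem _ ω (pf_mem 4))

/-! ### The eight translates of the eigenvector are independent. -/

/-- The coordinates of the translates of `eigenTuple ω` are `translate₀ + ω * translate₁`. -/
def translate₀ : Matrix (Fin 8) (Fin 8) ℤ :=
  !![2, 2, -1, -1, -1, -1, -1, 2; -2, -1, 0, -2, 1, 0, 1, -1; 0, -2, 2, 1, -1, -1, 1, -1;
    1, 0, 1, 2, 0, 1, 0, -2; 0, 1, -2, 0, 1, -1, -1, 0; -2, 0, 1, 0, 1, 0, 1, 1;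
    -1, -2, 2, 2, 0, 1, -1, 0; -1, -1, 0, 1, -1, 1, 0, -2]

/-- The other part of the matrix started in `translate₀`. -/
def translate₁ : Matrix (Fin 8) (Fin 8) ℤ :=
  !![1, 1, 1, 1, -2, -2, -2, 1; -1, 1, 0, -1, 2, 0, -1, 1; 0, -1, 1, 2, -2, -2, -1, 1;
    -1, 0, 2, 1, 0, 2, 0, -1; 0, -1, -1, 0, -1, -2, -2, 0; -1, 0, 2, 0, -1, 0, 2, -1;
    1, -1, 1, 1, 0, -1, -2, 0; 1, 1, 0, 2, -2, -1, 0, -1]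

/-- `inverse₀ + ω * inverse₁` is `21` times the inverse of `translate₀ + ω * translate₁`. -/
def inverse₀ : Matrix (Fin 8) (Fin 8) ℤ :=
  !![3, -1, 3, 3, -1, -1, -2, -1; -2, -2, -1, -2, 3, -2, -1, -2; -2, -2, 3, -2, -1, -2, -2, -1;
    -1, -1, -2, 3, 3, 3, 3, -2; -1, -2, 3, 3, 3, 3, -2, -1; 3, -1, -1, -2, -1, -1, 3, 3;
    2, 2, 1, 2, 2, 1, 2, -3; 3, -1, -2, -1, -1, 3, 3, -1]

/-- The other part of the matrix started in `inverse₀`. -/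
def inverse₁ : Matrix (Fin 8) (Fin 8) ℤ :=
  !![1, 2, 1, 1, 2, 2, -3, 2; -3, -3, 2, -3, 1, -3, 2, -3; -3, -3, 1, -3, 2, -3, -3, 2;
    2, 2, -3, 1, 1, 1, 1, -3; 2, -3, 1, 1, 1, 1, -3, 2; 1, 2, 2, -3, 2, 2, 1, 1;
    3, 3, -2, 3, 3, -2, 3, -1; 1, 2, -3, 2, 2, 1, 1, 2]

-- Substituting ω² = -1 - ω in `eigenTuple` gives `pf 1 - pf 2` as the constant part and `pf 4 - pf
-- 2` as the coefficient of ω.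
set_option maxRecDepth 20000 in
lemma translate₀_eq : translate₀ = Matrix.of fun i j =>
    pf 1 (cosetRepInv i ∘ coordTuple j) - pf 2 (cosetRepInv i ∘ coordTuple j) := by
  decide

set_option maxRecDepth 20000 in
lemma translate₁_eq : translate₁ = Matrix.of fun i j =>
    pf 4 (cosetRepInv i ∘ coordTuple j) - pf 2 (cosetRepInv i ∘ coordTuple j) := by
  decide

-- Since ω² = -1 - ω, the product (A + ωB)(C + ωD) has constant part AC - BD, and its coefficient of
-- ω is AD + BC - BD.
set_option maxRecDepth 20000 in
lemma inverse_mul_translate₀ : inverse₀ * translate₀ - inverse₁ * translate₁ = 21 • 1 := by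
  decide

set_option maxRecDepth 20000 in
lemma inverse_mul_translate₁ :
    inverse₀ * translate₁ + inverse₁ * translate₀ - inverse₁ * translate₁ = 0 := by
  decide

lemma sum_inverse_mul_eigenTuple {ω : ℂ} (hω : ω ^ 2 + ω + 1 = 0) (j l : Fin 8) :
    ∑ i, (inverse₀ j i + ω * inverse₁ j i : ℂ) *
      eigenTuple ω (cosetRepInv i ∘ coordTuple l) = if j = l then 21 else 0 := by
  have h0 := congr($inverse_mul_translate₀ j l)
  have h1 := congr($inverse_mul_translate₁ j l)
  simp only [Matrix.sub_apply, Matrix.add_apply, Matrix.mul_apply, Matrix.zero_apply,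
    Matrix.smul_apply, Matrix.one_apply] at h0 h1
  have h0' := congrArg (Int.cast : ℤ → ℂ) h0
  have h1' := congrArg (Int.cast : ℤ → ℂ) h1
  push_cast at h0' h1'
  have he : ∀ i, eigenTuple ω (cosetRepInv i ∘ coordTuple l) =
      translate₀ i l + ω * translate₁ i l := by
    intro i
    rw [eigenTuple, translate₀_eq, translate₁_eq, Matrix.of_apply, Matrix.of_apply]
    push_cast
    linear_combination (pf 2 (cosetRepInv i ∘ coordTuple l) : ℂ) * hω
  have : ∑ i, (inverse₀ j i + ω * inverse₁ j i : ℂ) *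
      eigenTuple ω (cosetRepInv i ∘ coordTuple l) =
      (∑ i, (inverse₀ j i : ℂ) * translate₀ i l - ∑ i, (inverse₁ j i : ℂ) * translate₁ i l) +
      ω * (∑ i, (inverse₀ j i : ℂ) * translate₁ i l + ∑ i, (inverse₁ j i : ℂ) * translate₀ i l -
        ∑ i, (inverse₁ j i : ℂ) * translate₁ i l) := by
    simp only [← Finset.sum_add_distrib, ← Finset.sum_sub_distrib, Finset.mul_sum]
    refine Finset.sum_congr rfl fun i _ => ?_
    rw [he]
    linear_combination (inverse₁ j i * translate₁ i l : ℂ) * hω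
  rw [this, h0', h1']
  split_ifs <;> simp

lemma tupleCoeff_homologyRep_of_inv {g : Matrix.SpecialLinearGroup (Fin 3) (ZMod 2)}
    {h : Fin 7 → Fin 7} (hg : ∀ x, (g : Matrix _ _ (ZMod 2)).mulVec (pt (h x)) = pt x)
    (z : homologyIR 3 3) (d : Fin 4 → Fin 7) :
    tupleCoeff (homologyRep 3 3 g z) d = tupleCoeff z (h ∘ d) := by
  have hinj : Function.Injective h := fun x y hxy =>
    pt_injective (by rw [← hg x, ← hg y, hxy])
  let π : Equiv.Perm (Fin 7) := (Equiv.ofBijective h (Finite.injective_iff_bijective.1 hinj)).symm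
  have hπ : ∀ x, π (h x) = x := fun x => Equiv.ofBijective_symm_apply_apply h _ x
  have hg' : ∀ x, (g : Matrix _ _ (ZMod 2)).mulVec (pt x) = pt (π x) := by
    intro x
    obtain ⟨y, rfl⟩ := (Finite.injective_iff_bijective.1 hinj).2 x
    rw [hg, hπ]
  rw [← tupleCoeff_homologyRep hg' z (h ∘ d)]
  exact congrArg (tupleCoeff _) (funext fun i => (hπ (d i)).symm)

/-! ### Elements of `SL(3, 𝔽₂)` -/

lemma frob_mulVec_pt : ∀ i, (frob : Matrix _ _ (ZMod 2)).mulVec (pt i) = pt (2 * i) := by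
  decide

lemma invol_mulVec_pt : ∀ i,
    (invol : Matrix _ _ (ZMod 2)).mulVec (pt (![1, 0, 2, 3, 6, 5, 4] i)) = pt i := by
  decide

lemma singer_pow_mulVec_pt (m : ℕ) (i : Fin 7) :
    ((singer ^ m : Matrix.SpecialLinearGroup (Fin 3) (ZMod 2)) : Matrix _ _ (ZMod 2)).mulVec (pt i) =
      pt (i + Fin.ofNat 7 m) := by
  induction m generalizing i with
  | zero => simp
  | succ m ih =>
    rw [pow_succ, Matrix.SpecialLinearGroup.coe_mul, ← Matrix.mulVec_mulVec, singer_mulVec_pt, ih]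
    congr 1
    rw [add_assoc]
    congr 1
    ext
    simp [Fin.val_add, add_comm]

lemma frob_pow_mulVec_pt (m : ℕ) (i : Fin 7) :
    ((frob ^ m : Matrix.SpecialLinearGroup (Fin 3) (ZMod 2)) : Matrix _ _ (ZMod 2)).mulVec (pt i) =
      pt ((2 * ·)^[m] i) := by
  induction m generalizing i with
  | zero => simp
  | succ m ih =>
    rw [pow_succ, Matrix.SpecialLinearGroup.coe_mul, ← Matrix.mulVec_mulVec, frob_mulVec_pt, ih]
    rfl

lemma cosetRep_mulVec_pt (i : Fin 8) (x : Fin 7) :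
    (cosetRep i : Matrix _ _ (ZMod 2)).mulVec (pt (cosetRepInv i x)) = pt x := by
  induction i using Fin.cases with
  | zero => simp [cosetRep, cosetRepInv]
  | succ j =>
    simp only [cosetRep, cosetRepInv, Fin.cases_succ]
    rw [Matrix.SpecialLinearGroup.coe_mul, ← Matrix.mulVec_mulVec, invol_mulVec_pt,
      singer_pow_mulVec_pt]
    simp

lemma eq_of_mulVec_pt {g h : Matrix.SpecialLinearGroup (Fin 3) (ZMod 2)}
    (h0 : (g : Matrix (Fin 3) (Fin 3) (ZMod 2)).mulVec (pt 0) = (h : Matrix (Fin 3) (Fin 3) (ZMod 2)).mulVec (pt 0))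
    (h1 : (g : Matrix (Fin 3) (Fin 3) (ZMod 2)).mulVec (pt 1) = (h : Matrix (Fin 3) (Fin 3) (ZMod 2)).mulVec (pt 1))
    (h2 : (g : Matrix (Fin 3) (Fin 3) (ZMod 2)).mulVec (pt 2) = (h : Matrix (Fin 3) (Fin 3) (ZMod 2)).mulVec (pt 2)) :
    g = h := by
  refine Subtype.ext (Matrix.ext fun i j => ?_)
  have e0 := congrFun h0 i
  have e1 := congrFun h1 i
  have e2 := congrFun h2 i
  simp only [Matrix.mulVec, dotProduct, Fin.sum_univ_three, pt, Matrix.cons_val, mul_one, mul_zero,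
    add_zero, zero_add] at e0 e1 e2
  fin_cases j
  exacts [e0, e1, e2]

lemma singer_pow_seven : singer ^ 7 = 1 := by
  apply eq_of_mulVec_pt <;> rw [singer_pow_mulVec_pt] <;> simp

lemma frob_pow_three : frob ^ 3 = 1 := by
  apply eq_of_mulVec_pt <;> rw [frob_pow_mulVec_pt] <;> simp

lemma frob_mul_singer : frob * singer = singer ^ 2 * frob := by
  apply eq_of_mulVec_pt <;>
    rw [Matrix.SpecialLinearGroup.coe_mul, Matrix.SpecialLinearGroup.coe_mul,
      ← Matrix.mulVec_mulVec, ← Matrix.mulVec_mulVec, singer_mulVec_pt, frob_mulVec_pt,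
      frob_mulVec_pt, singer_pow_mulVec_pt] <;> rfl

/-- The triple (a, b, c) stands for the images of points 0, 1, 2 under a group element. Undoing a
suitable coset representative turns it into the image of (0, 1, 2) under some x ↦ 2ᵏx + m, that is,
under an element of the normalizer. -/
lemma exists_cosetRep_index : ∀ a b c : Fin 7, a ≠ b → pt a + pt b + pt c ≠ 0 → a ≠ c → b ≠ c →
    ∃ i : Fin 8, ∃ k : Fin 3,
      cosetRepInv i b = (2 * ·)^[k.val] 1 + cosetRepInv i a ∧
      cosetRepInv i c = (2 * ·)^[k.val] 2 + cosetRepInv i a := by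
  decide

/-- Every element of `SL(3, 𝔽₂)` lies in one of the eight cosets of the normalizer of the Singer
cycle. -/
lemma exists_eq_cosetRep_mul (g : Matrix.SpecialLinearGroup (Fin 3) (ZMod 2)) :
    ∃ i, ∃ m n : ℕ, g = cosetRep i * (singer ^ m * frob ^ n) := by
  have hinj : Function.Injective (g : Matrix (Fin 3) (Fin 3) (ZMod 2)).mulVec :=
    (Matrix.SpecialLinearGroup.toLin' g).injective
  have hex : ∀ x, ∃ a, pt a = (g : Matrix (Fin 3) (Fin 3) (ZMod 2)).mulVec (pt x) := fun x =>
    exists_pt_eq _ fun h => pt_ne_zero x (hinj (by rw [h, Matrix.mulVec_zero]))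
  obtain ⟨a, ha⟩ := hex 0
  obtain ⟨b, hb⟩ := hex 1
  obtain ⟨c, hc⟩ := hex 2
  have hne : ∀ x y : Fin 7, x ≠ y →
      (g : Matrix (Fin 3) (Fin 3) (ZMod 2)).mulVec (pt x) ≠ (g : Matrix (Fin 3) (Fin 3) (ZMod 2)).mulVec (pt y) :=
    fun x y hxy h => hxy (pt_injective (hinj h))
  obtain ⟨i, k, h1, h2⟩ := exists_cosetRep_index a b c
    (by rintro rfl; exact hne 0 1 (by decide) (ha.symm.trans hb))
    (by
      rw [ha, hb, hc, ← Matrix.mulVec_add, ← Matrix.mulVec_add]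
      intro h
      have h3 : pt 0 + pt 1 + pt 2 = 0 := hinj (by rw [h, Matrix.mulVec_zero])
      revert h3
      decide)
    (by rintro rfl; exact hne 0 2 (by decide) (ha.symm.trans hc))
    (by rintro rfl; exact hne 1 2 (by decide) (hb.symm.trans hc))
  have hz : (2 * ·)^[k.val] (0 : Fin 7) = 0 := by clear h1 h2; revert k; decide
  have hj : Fin.ofNat 7 (cosetRepInv i a).val = cosetRepInv i a := by simp
  refine ⟨i, (cosetRepInv i a).val, k.val, ?_⟩
  apply eq_of_mulVec_pt <;>
    rw [Matrix.SpecialLinearGroup.coe_mul, Matrix.SpecialLinearGroup.coe_mul,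
      ← Matrix.mulVec_mulVec, ← Matrix.mulVec_mulVec, frob_pow_mulVec_pt, singer_pow_mulVec_pt, hj]
  · rw [hz, zero_add, cosetRep_mulVec_pt, ha]
  · rw [← h1, cosetRep_mulVec_pt, hb]
  · rw [← h2, cosetRep_mulVec_pt, hc]

/-! ### The homology representation -/

/-- The coordinates of a homology class. -/
noncomputable def coord : homologyIR 3 3 →ₗ[ℂ] (Fin 8 → ℂ) :=
  LinearMap.pi fun i => LinearMap.proj (coordTuple i) ∘ₗ tupleCoeff

lemma coord_apply (z : homologyIR 3 3) (i : Fin 8) : coord z i = tupleCoeff z (coordTuple i) := rfl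

lemma coord_injective : Function.Injective coord := by
  rw [injective_iff_map_eq_zero]
  intro z hz
  refine tupleCoeff_injective ?_
  rw [map_zero]
  exact eq_zero_of_coordTuple (tupleCoeff_mem z) fun i => congrFun hz i

/-- An eigenvector of the normalizer of the Singer cycle in homology. -/
noncomputable def eigenClass (ω : ℂ) : homologyIR 3 3 :=
  tupleEquiv.symm ⟨eigenTuple ω, eigenTuple_mem ω⟩

lemma tupleCoeff_eigenClass (ω : ℂ) : tupleCoeff (eigenClass ω) = eigenTuple ω := by
  rw [← coe_tupleEquiv, eigenClass, LinearEquiv.apply_symm_apply]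

lemma singer_inv_mulVec_pt : ∀ x, (singer : Matrix _ _ (ZMod 2)).mulVec (pt (x - 1)) = pt x := by
  decide

lemma frob_inv_mulVec_pt : ∀ x, (frob : Matrix _ _ (ZMod 2)).mulVec (pt (4 * x)) = pt x := by
  decide

lemma homologyRep_singer_eigenClass (ω : ℂ) :
    homologyRep 3 3 singer (eigenClass ω) = eigenClass ω := by
  refine tupleCoeff_injective (funext fun d => ?_)
  rw [tupleCoeff_homologyRep_of_inv singer_inv_mulVec_pt, tupleCoeff_eigenClass]
  have h : ∀ k, pf k (fun i => d i - 1) = pf k d := fun k => by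
    rw [← pf_shift]; simp
  change eigenTuple ω (fun i => d i - 1) = _
  simp only [eigenTuple, h]

lemma homologyRep_frob_eigenClass {ω : ℂ} (hω : ω ^ 2 + ω + 1 = 0) :
    homologyRep 3 3 frob (eigenClass ω) = ω • eigenClass ω := by
  refine tupleCoeff_injective (funext fun d => ?_)
  rw [tupleCoeff_homologyRep_of_inv frob_inv_mulVec_pt, map_smul, tupleCoeff_eigenClass]
  have h : ∀ k, pf k (fun i => 4 * d i) = pf (2 * k) d := fun k => by
    rw [← pf_double]
    congr 1
    funext i
    generalize d i = x
    revert x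
    decide
  change eigenTuple ω (fun i => 4 * d i) = ω * _
  simp only [eigenTuple, h]
  rw [show (2 * 1 : Fin 7) = 2 by decide, show (2 * 2 : Fin 7) = 4 by decide,
    show (2 * 4 : Fin 7) = 1 by decide]
  linear_combination (pf 2 d : ℂ) * (1 - ω) * hω

lemma coord_homologyRep_eigenClass (ω : ℂ) (i l : Fin 8) :
    coord (homologyRep 3 3 (cosetRep i) (eigenClass ω)) l =
      eigenTuple ω (cosetRepInv i ∘ coordTuple l) := by
  rw [coord_apply, tupleCoeff_homologyRep_of_inv (cosetRep_mulVec_pt i), tupleCoeff_eigenClass]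

lemma exists_mem_span_coord_eq {ω : ℂ} (hω : ω ^ 2 + ω + 1 = 0) (f : Fin 8 → ℂ) :
    ∃ z ∈ Submodule.span ℂ (Set.range fun i => homologyRep 3 3 (cosetRep i) (eigenClass ω)),
      coord z = f := by
  -- The coefficients come from the inverse matrix, which was scaled by 21 to stay in ℤ[ω].
  refine ⟨∑ j, (f j / 21) • ∑ i, (inverse₀ j i + ω * inverse₁ j i : ℂ) •
    homologyRep 3 3 (cosetRep i) (eigenClass ω), ?_, ?_⟩
  · refine Submodule.sum_mem _ fun j _ => Submodule.smul_mem _ _ (Submodule.sum_mem _ fun i _ =>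
      Submodule.smul_mem _ _ (Submodule.subset_span ⟨i, rfl⟩))
  · funext l
    simp only [map_sum, map_smul, Finset.sum_apply, Pi.smul_apply, coord_homologyRep_eigenClass,
      smul_eq_mul, sum_inverse_mul_eigenTuple hω]
    simp

lemma finrank_homologyIR_of_root {ω : ℂ} (hω : ω ^ 2 + ω + 1 = 0) :
    Module.finrank ℂ (homologyIR 3 3) = 8 := by
  have := LinearEquiv.finrank_eq (LinearEquiv.ofBijective coord
    ⟨coord_injective, fun f => (exists_mem_span_coord_eq hω f).imp fun _ h => h.2⟩)
  rw [this]
  simp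

lemma span_eigenClass_eq_top {ω : ℂ} (hω : ω ^ 2 + ω + 1 = 0) :
    Submodule.span ℂ (Set.range fun i => homologyRep 3 3 (cosetRep i) (eigenClass ω)) = ⊤ := by
  rw [eq_top_iff]
  intro z _
  obtain ⟨w, hw, h⟩ := exists_mem_span_coord_eq hω (coord z)
  exact coord_injective h ▸ hw

/-- All eight coordinate tuples lie in one orbit of the normalizer, so a single coordinate
determines an eigenvector. -/
lemma coordTuple_cases : ∀ j, ∃ m : Fin 7, coordTuple j = (fun i => coordTuple 0 i + m) ∨
    coordTuple j = (fun i => 2 * coordTuple 0 i + m) ∨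
    coordTuple j = (fun i => 4 * coordTuple 0 i + m) := by
  decide

lemma eq_zero_of_eigenvector {ω : ℂ} {z : homologyIR 3 3}
    (h1 : homologyRep 3 3 singer z = z) (h2 : homologyRep 3 3 frob z = ω • z)
    (h0 : coord z 0 = 0) : z = 0 := by
  have hshift : ∀ d (m : ℕ), tupleCoeff z (fun i => d i + Fin.ofNat 7 m) = tupleCoeff z d := by
    intro d m
    induction m with
    | zero => simp
    | succ m ih =>
      have h := congr(tupleCoeff $h1 (fun i => d i + Fin.ofNat 7 (m + 1)))
      rw [tupleCoeff_homologyRep_of_inv singer_inv_mulVec_pt] at h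
      rw [← h, ← ih]
      refine congrArg (tupleCoeff z) (funext fun i => ?_)
      have : Fin.ofNat 7 (m + 1) = Fin.ofNat 7 m + 1 := by ext; simp [Fin.val_add]
      rw [Function.comp_apply, this, ← add_assoc, add_sub_cancel_right]
  have hshift' : ∀ d (m : Fin 7), tupleCoeff z (fun i => d i + m) = tupleCoeff z d := by
    intro d m
    simpa using hshift d m.val
  have hfour : ∀ d, tupleCoeff z (fun i => 4 * d i) = ω * tupleCoeff z d := by
    intro d
    have h := congr(tupleCoeff $h2 d)
    rw [tupleCoeff_homologyRep_of_inv frob_inv_mulVec_pt, map_smul] at h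
    exact h
  have htwo : ∀ d, tupleCoeff z (fun i => 2 * d i) = ω * (ω * tupleCoeff z d) := by
    intro d
    -- In ℤ/7 one has 2 = 4 · 4.
    rw [← hfour, ← hfour]
    refine congrArg (tupleCoeff z) (funext fun i => ?_)
    generalize d i = x
    revert x
    decide
  refine coord_injective ?_
  rw [map_zero]
  funext j
  rw [coord_apply] at h0
  obtain ⟨m, h | h | h⟩ := coordTuple_cases j <;> rw [coord_apply, h]
  · rw [hshift', h0]; rfl
  · rw [hshift' (fun i => 2 * coordTuple 0 i), htwo, h0, mul_zero, mul_zero]; rfl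
  · rw [hshift' (fun i => 4 * coordTuple 0 i), hfour, h0, mul_zero]; rfl

lemma coord_eigenClass_ne_zero {ω : ℂ} (hω : ω ^ 2 + ω + 1 = 0) : coord (eigenClass ω) 0 ≠ 0 := by
  rw [coord_apply, tupleCoeff_eigenClass, eigenTuple,
    show pf 1 (coordTuple 0) = 1 by decide, show pf 2 (coordTuple 0) = -1 by decide,
    show pf 4 (coordTuple 0) = 0 by decide]
  intro h
  push_cast at h
  have h1 : ω = -2 := by linear_combination hω + h
  rw [h1] at hω
  norm_num at hω

lemma mem_span_eigenClass {ω : ℂ} (hω : ω ^ 2 + ω + 1 = 0) {z : homologyIR 3 3}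
    (h1 : homologyRep 3 3 singer z = z) (h2 : homologyRep 3 3 frob z = ω • z) :
    ∃ c : ℂ, z = c • eigenClass ω := by
  refine ⟨coord z 0 / coord (eigenClass ω) 0, sub_eq_zero.1 (eq_zero_of_eigenvector (ω := ω) ?_ ?_ ?_)⟩
  · rw [map_sub, map_smul, h1, homologyRep_singer_eigenClass]
  · rw [map_sub, map_smul, h2, homologyRep_frob_eigenClass hω, smul_sub, smul_comm]
  · rw [map_sub, map_smul, Pi.sub_apply, Pi.smul_apply, smul_eq_mul,
      div_mul_cancel₀ _ (coord_eigenClass_ne_zero hω), sub_self]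

/-! ### Representations of `SL(3, 𝔽₂)` with a vector fixed by the Singer cycle -/

section Representation

variable {V : Type*} [AddCommGroup V] [Module ℂ V]
  {σ : Representation ℂ (Matrix.SpecialLinearGroup (Fin 3) (ZMod 2)) V}

lemma apply_pow_of_eigenvector {g : Matrix.SpecialLinearGroup (Fin 3) (ZMod 2)} {v : V} {c : ℂ}
    (h : σ g v = c • v) (n : ℕ) : σ (g ^ n) v = c ^ n • v := by
  induction n with
  | zero => simp
  | succ n ih => rw [pow_succ, map_mul, Module.End.mul_apply, h, map_smul, ih, smul_smul, pow_succ']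

lemma apply_cosetRep_mul {v : V} {ζ : ℂ} (hA : σ singer v = v) (hB : σ frob v = ζ • v) (i : Fin 8)
    (m n : ℕ) : σ (cosetRep i * (singer ^ m * frob ^ n)) v = ζ ^ n • σ (cosetRep i) v := by
  have hA' : σ (singer ^ m) v = v := by
    simpa using apply_pow_of_eigenvector (c := 1) (hA.trans (one_smul ℂ v).symm) m
  rw [map_mul, map_mul, Module.End.mul_apply, Module.End.mul_apply,
    apply_pow_of_eigenvector hB, map_smul, map_smul, hA']

/-- The subrepresentation generated by an eigenvector of the normalizer of the Singer cycle. -/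
def spanCosetReps {v : V} {ζ : ℂ} (hA : σ singer v = v) (hB : σ frob v = ζ • v) :
    Subrepresentation σ where
  toSubmodule := Submodule.span ℂ (Set.range fun i => σ (cosetRep i) v)
  apply_mem_toSubmodule g w hw := by
    rw [← Submodule.mem_comap]
    refine Submodule.span_le.2 ?_ hw
    rintro _ ⟨i, rfl⟩
    obtain ⟨j, m, n, h⟩ := exists_eq_cosetRep_mul (g * cosetRep i)
    rw [SetLike.mem_coe, Submodule.mem_comap, ← Module.End.mul_apply, ← map_mul, h,
      apply_cosetRep_mul hA hB]
    exact Submodule.smul_mem _ _ (Submodule.subset_span ⟨j, rfl⟩)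

lemma mem_spanCosetReps {v : V} {ζ : ℂ} (hA : σ singer v = v) (hB : σ frob v = ζ • v) :
    v ∈ (spanCosetReps hA hB).toSubmodule :=
  Submodule.subset_span ⟨0, by simp [cosetRep]⟩

lemma span_cosetReps_eq_top (hσ : σ.IsIrreducible) {v : V} {ζ : ℂ} (hv : v ≠ 0)
    (hA : σ singer v = v) (hB : σ frob v = ζ • v) :
    Submodule.span ℂ (Set.range fun i => σ (cosetRep i) v) = ⊤ := by
  obtain h | h := eq_bot_or_eq_top (spanCosetReps hA hB)
  · have h0 := mem_spanCosetReps hA hB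
    rw [h] at h0
    exact absurd ((Submodule.mem_bot ℂ).1 h0) hv
  · exact congrArg Subrepresentation.toSubmodule h

/-- The trace is constant on the coset `C * singer ^ k`, while the sum over the coset is `σ C`
composed with zero. Hence seven times the trace vanishes. -/
lemma trace_eq_zero_of_conj {C : Matrix.SpecialLinearGroup (Fin 3) (ZMod 2)}
    (hC : ∀ k, ∃ h, C * singer ^ k = h * C * h⁻¹)
    (hE : ∑ k ∈ Finset.range 7, σ (singer ^ k) = 0) : LinearMap.trace ℂ V (σ C) = 0 := by
  have h1 : ∀ k, LinearMap.trace ℂ V (σ (C * singer ^ k)) = LinearMap.trace ℂ V (σ C) := by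
    intro k
    obtain ⟨h, hk⟩ := hC k
    rw [hk, map_mul, LinearMap.trace_mul_comm, ← map_mul, ← mul_assoc, inv_mul_cancel, one_mul]
  have h2 : ∑ k ∈ Finset.range 7, LinearMap.trace ℂ V (σ (C * singer ^ k)) = 0 := by
    simp_rw [map_mul]
    rw [← map_sum, ← Finset.mul_sum, hE, mul_zero, map_zero]
  simp_rw [h1] at h2
  simpa using h2

lemma frob_semiconjBy : SemiconjBy frob singer (singer ^ 2) := frob_mul_singer

/-- Conjugating `frob` by `singer ^ 5` gives `frob * singer`, so powers of `singer ^ 5` reach the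
whole coset. -/
lemma exists_conj_frob (k : ℕ) : ∃ h, frob * singer ^ k = h * frob * h⁻¹ := by
  have h : frob * (singer ^ 6) ^ k = (singer ^ 5) ^ k * frob := by
    have h6 : SemiconjBy frob (singer ^ 6) (singer ^ 5) := by
      have := frob_semiconjBy.pow_right 6
      rwa [← pow_mul, show 2 * 6 = 7 + 5 from rfl, pow_add, singer_pow_seven, one_mul] at this
    exact h6.pow_right k
  refine ⟨(singer ^ 5) ^ k, ?_⟩
  rw [eq_mul_inv_iff_mul_eq, ← h, mul_assoc, ← pow_mul, ← pow_mul, ← pow_add]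
  congr 2
  omega

lemma exists_conj_frob_sq (k : ℕ) : ∃ h, frob ^ 2 * singer ^ k = h * frob ^ 2 * h⁻¹ := by
  have h : frob ^ 2 * (singer ^ 2) ^ k = singer ^ k * frob ^ 2 := by
    have h2 : SemiconjBy (frob ^ 2) (singer ^ 2) singer := by
      have h4 : SemiconjBy frob (singer ^ 2) (singer ^ 4) := by
        have := frob_semiconjBy.pow_right 2
        rwa [← pow_mul] at this
      have h8 : SemiconjBy frob (singer ^ 4) singer := by
        have := frob_semiconjBy.pow_right 4
        rwa [← pow_mul, show 2 * 4 = 7 + 1 from rfl, pow_add, singer_pow_seven, one_mul,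
          pow_one] at this
      rw [pow_two frob]
      exact h8.mul_left h4
    exact h2.pow_right k
  refine ⟨singer ^ k, ?_⟩
  rw [eq_mul_inv_iff_mul_eq, ← h, mul_assoc, ← pow_mul, ← pow_add, two_mul]

lemma exists_singer_fixed (hV : Module.finrank ℂ V = 8) : ∃ v : V, v ≠ 0 ∧ σ singer v = v := by
  by_contra! hcon
  have : FiniteDimensional ℂ V := Module.finite_of_finrank_pos (by omega)
  -- Every value of this sum is fixed by the Singer cycle.
  have hE : ∑ k ∈ Finset.range 7, σ (singer ^ k) = 0 := by
    refine LinearMap.ext fun v => by_contra fun hv => hcon _ hv ?_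
    rw [LinearMap.sum_apply, map_sum]
    simp_rw [← Module.End.mul_apply, ← map_mul, ← pow_succ']
    rw [Finset.sum_range_succ, Finset.sum_range_succ' _ 6, singer_pow_seven, pow_zero]
  have h1 := trace_eq_zero_of_conj exists_conj_frob hE
  have h2 := trace_eq_zero_of_conj exists_conj_frob_sq hE
  -- This is the projection onto the vectors fixed by `frob`. Its trace would be 8/3, yet it equals
  -- the rank.
  set P : Module.End ℂ V := (3⁻¹ : ℂ) • (1 + σ frob + σ (frob ^ 2)) with hP
  have h3 : σ frob * σ frob * σ frob = 1 := by
    rw [← map_mul, ← map_mul, ← pow_two, ← pow_succ, frob_pow_three, map_one]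
  have hidem : IsIdempotentElem P := by
    rw [IsIdempotentElem, hP, pow_two, map_mul, smul_mul_smul_comm]
    have : (1 + σ frob + σ frob * σ frob) * (1 + σ frob + σ frob * σ frob) =
        (3 : ℂ) • (1 + σ frob + σ frob * σ frob) := by
      have h4 : σ frob * (σ frob * σ frob) = 1 := by rw [← mul_assoc, h3]
      have h5 : σ frob * σ frob * (σ frob * σ frob) = σ frob := by rw [← mul_assoc, h3, one_mul]
      simp only [add_mul, mul_add, h3, h4, h5, one_mul, mul_one]
      module
    rw [this, smul_smul]
    norm_num
  have htr := (LinearMap.IsIdempotentElem.isProj_range P hidem).trace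
  rw [hP, map_smul, map_add, map_add, h1, h2, LinearMap.trace_one, hV] at htr
  have : (8 : ℂ) = 3 * (Module.finrank ℂ (LinearMap.range P) : ℕ) := by
    rw [← htr]; norm_num
  have : 8 = 3 * Module.finrank ℂ (LinearMap.range P) := by exact_mod_cast this
  omega

/-- Since `frob` normalizes the Singer cycle, it preserves the nonzero fixed space and has an
eigenvector there. -/
lemma exists_eigenvector (hV : Module.finrank ℂ V = 8) :
    ∃ v : V, v ≠ 0 ∧ σ singer v = v ∧ ∃ ζ : ℂ, ζ ^ 3 = 1 ∧ σ frob v = ζ • v := by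
  have : FiniteDimensional ℂ V := Module.finite_of_finrank_pos (by omega)
  obtain ⟨v₀, hv₀, hA₀⟩ := exists_singer_fixed (σ := σ) hV
  let K := LinearMap.eqLocus (σ singer) LinearMap.id
  have hK : ∀ v ∈ K, σ frob v ∈ K := by
    intro v hv
    rw [LinearMap.mem_eqLocus, LinearMap.id_apply] at hv ⊢
    have h4 : singer * frob = frob * singer ^ 4 := by
      have := frob_semiconjBy.pow_right 4
      rw [← pow_mul, show 2 * 4 = 7 + 1 from rfl, pow_add, singer_pow_seven, one_mul,
        pow_one] at this
      exact this.symm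
    have h5 : σ (singer ^ 4) v = v := by
      simpa using apply_pow_of_eigenvector (c := 1) (hv.trans (one_smul ℂ v).symm) 4
    rw [← Module.End.mul_apply, ← map_mul, h4, map_mul, Module.End.mul_apply, h5]
  have : Nontrivial K := ⟨⟨⟨v₀, hA₀⟩, 0, fun h => hv₀ congr($h.1)⟩⟩
  obtain ⟨ζ, hζ⟩ := Module.End.exists_eigenvalue ((σ frob).restrict hK)
  obtain ⟨v, hv⟩ := hζ.exists_hasEigenvector
  have hB : σ frob v = ζ • (v : V) := congr($(hv.apply_eq_smul).1)
  have hv0 : (v : V) ≠ 0 := fun h => hv.2 (Subtype.ext h)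
  refine ⟨v, hv0, v.2, ζ, ?_, hB⟩
  have := apply_pow_of_eigenvector hB 3
  rw [frob_pow_three, map_one, Module.End.one_apply] at this
  refine smul_left_injective ℂ hv0 ?_
  simp [← this]

lemma linearIndependent_cosetReps (hσ : σ.IsIrreducible) (hV : Module.finrank ℂ V = 8)
    {v : V} {ζ : ℂ} (hv : v ≠ 0) (hA : σ singer v = v) (hB : σ frob v = ζ • v) :
    LinearIndependent ℂ fun i => σ (cosetRep i) v :=
  linearIndependent_of_top_le_span_of_card_eq_finrank (span_cosetReps_eq_top hσ hv hA hB).ge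
    (by rw [hV, Fintype.card_fin])

lemma eq_zero_of_invariant (hσ : σ.IsIrreducible) (hV : Module.finrank ℂ V = 8) {u : V}
    (hu : ∀ g, σ g u = u) : u = 0 := by
  by_contra h0
  have h := span_cosetReps_eq_top (ζ := 1) hσ h0 (hu _) (by rw [hu, one_smul])
  simp only [hu, Set.range_const] at h
  have := finrank_span_singleton (K := ℂ) h0
  rw [h, finrank_top, hV] at this
  omega

/-- With eigenvalue 1 the group would permute the eight translates. The sum over the group is
invariant, hence zero, contradicting independence of the translates. -/
lemma frob_eigenvalue_ne_one (hσ : σ.IsIrreducible) (hV : Module.finrank ℂ V = 8) {v : V}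
    (hv : v ≠ 0) (hA : σ singer v = v) : σ frob v ≠ v := by
  intro hB
  have hB' : σ frob v = (1 : ℂ) • v := by rw [hB, one_smul]
  have hex : ∀ g, ∃ i, σ g v = σ (cosetRep i) v := by
    intro g
    obtain ⟨i, m, n, rfl⟩ := exists_eq_cosetRep_mul g
    exact ⟨i, by rw [apply_cosetRep_mul hA hB', one_pow, one_smul]⟩
  choose f hf using hex
  have h0 : ∑ g, σ g v = 0 := by
    refine eq_zero_of_invariant hσ hV fun h => ?_
    rw [map_sum]
    simp_rw [← Module.End.mul_apply, ← map_mul]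
    exact Fintype.sum_equiv (Equiv.mulLeft h) _ _ fun _ => rfl
  have hli := linearIndependent_cosetReps hσ hV hv hA hB'
  -- The coefficients of the group sum in the translates; they add up to the order of the group,
  -- which is not zero.
  let L : (Fin 8 →₀ ℂ) := ∑ g, Finsupp.single (f g) 1
  have hL : L = 0 := by
    refine hli ?_
    rw [map_zero, map_sum, ← h0]
    refine Finset.sum_congr rfl fun g _ => ?_
    rw [Finsupp.linearCombination_single, one_smul, ← hf]
  have h1 := congrArg (Finsupp.linearCombination ℂ fun _ : Fin 8 => (1 : ℂ)) hL
  rw [map_sum, map_zero] at h1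
  simp at h1

/-- The group acts monomially on the eight translates. The target index `j` and the scalar `ζ ^ n`
depend only on `g` and `i`, so matching the two bases is equivariant. -/
lemma nonempty_equiv_of_eigenvectors {W : Type*} [AddCommGroup W] [Module ℂ W]
    {τ : Representation ℂ (Matrix.SpecialLinearGroup (Fin 3) (ZMod 2)) W}
    (hσ : σ.IsIrreducible) (hV : Module.finrank ℂ V = 8)
    (hτ : τ.IsIrreducible) (hW : Module.finrank ℂ W = 8) {v : V} {w : W} {ζ : ℂ}
    (hv : v ≠ 0) (hA : σ singer v = v) (hB : σ frob v = ζ • v)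
    (hw : w ≠ 0) (hA' : τ singer w = w) (hB' : τ frob w = ζ • w) : Nonempty (σ.Equiv τ) := by
  let b := Module.Basis.mk (linearIndependent_cosetReps hσ hV hv hA hB)
    (span_cosetReps_eq_top hσ hv hA hB).ge
  let c := Module.Basis.mk (linearIndependent_cosetReps hτ hW hw hA' hB')
    (span_cosetReps_eq_top hτ hw hA' hB').ge
  let e := b.equiv c (Equiv.refl _)
  have he : ∀ i, e (σ (cosetRep i) v) = τ (cosetRep i) w := by
    intro i
    have := b.equiv_apply i c (Equiv.refl _)
    simpa [b, c] using this
  refine ⟨Representation.Equiv.mk e fun g => b.ext fun i => ?_⟩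
  obtain ⟨j, m, n, h⟩ := exists_eq_cosetRep_mul (g * cosetRep i)
  simp only [b, Module.Basis.mk_apply, LinearMap.comp_apply, LinearEquiv.coe_coe, he]
  rw [← Module.End.mul_apply, ← Module.End.mul_apply, ← map_mul, ← map_mul, h,
    apply_cosetRep_mul hA hB, apply_cosetRep_mul hA' hB', map_smul, he]

end Representation

/-! ### Irreducibility and conclusion. -/

lemma exists_root : ∃ ω : ℂ, ω ^ 2 + ω + 1 = 0 := by
  obtain ⟨s, hs⟩ := IsAlgClosed.exists_pow_nat_eq (-3 : ℂ) two_pos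
  exact ⟨(s - 1) / 2, by linear_combination hs / 4⟩

lemma eigenClass_ne_zero {ω : ℂ} (hω : ω ^ 2 + ω + 1 = 0) : eigenClass ω ≠ 0 := by
  intro h
  apply coord_eigenClass_ne_zero hω
  rw [h, map_zero, Pi.zero_apply]

lemma eq_top_of_eigenClass_mem {ω : ℂ} (hω : ω ^ 2 + ω + 1 = 0)
    {M : Subrepresentation (homologyRep 3 3)} (h : eigenClass ω ∈ M.toSubmodule) : M = ⊤ := by
  refine Subrepresentation.toSubmodule_injective (top_le_iff.1 ?_)
  rw [← span_eigenClass_eq_top hω, Submodule.span_le]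
  rintro _ ⟨i, rfl⟩
  exact M.apply_mem_toSubmodule _ h

lemma isIrreducible_homologyRep : (homologyRep 3 3).IsIrreducible := by
  obtain ⟨ω, hω⟩ := exists_root
  have hne := eigenClass_ne_zero hω
  have : Nontrivial (Subrepresentation (homologyRep 3 3)) := by
    refine ⟨⟨⊥, ⊤, fun h => hne ?_⟩⟩
    have h1 : eigenClass ω ∈ (⊤ : Subrepresentation (homologyRep 3 3)).toSubmodule :=
      Submodule.mem_top
    rw [← h] at h1
    exact (Submodule.mem_bot ℂ).1 h1
  refine ⟨fun M => ?_⟩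
  -- Complete reducibility supplies the complement. The component of the eigenvector in `M`
  -- satisfies the same eigenvector equations, hence is a multiple of the eigenvector.
  obtain ⟨N, hMN⟩ := exists_isCompl M
  have hdis : Disjoint M.toSubmodule N.toSubmodule := by
    rw [disjoint_iff, ← Subrepresentation.toSubmodule_inf, hMN.inf_eq_bot]
    rfl
  have hv : eigenClass ω ∈ M.toSubmodule ⊔ N.toSubmodule := by
    rw [← Subrepresentation.toSubmodule_sup, hMN.sup_eq_top]
    exact Submodule.mem_top
  obtain ⟨m, hm, n, hn, hmn⟩ := Submodule.mem_sup.1 hv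
  have huniq : ∀ m' ∈ M.toSubmodule, ∀ n' ∈ N.toSubmodule, m' + n' = 0 → m' = 0 := by
    intro m' hm' n' hn' h
    refine Submodule.disjoint_def.1 hdis m' hm' ?_
    rw [eq_neg_of_add_eq_zero_left h]
    exact neg_mem hn'
  have hA : homologyRep 3 3 singer m = m := by
    refine sub_eq_zero.1 (huniq _ (sub_mem (M.apply_mem_toSubmodule _ hm) hm)
      _ (sub_mem (N.apply_mem_toSubmodule singer hn) hn) ?_)
    rw [sub_add_sub_comm, ← map_add, hmn, homologyRep_singer_eigenClass, sub_self]
  have hB : homologyRep 3 3 frob m = ω • m := by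
    refine sub_eq_zero.1 (huniq _ (sub_mem (M.apply_mem_toSubmodule _ hm) (M.toSubmodule.smul_mem _ hm))
      _ (sub_mem (N.apply_mem_toSubmodule frob hn) (N.toSubmodule.smul_mem ω hn)) ?_)
    rw [sub_add_sub_comm, ← map_add, ← smul_add, hmn, homologyRep_frob_eigenClass hω, sub_self]
  obtain ⟨c, hc⟩ := mem_span_eigenClass hω hA hB
  by_cases h0 : c = 0
  · left
    have hN : N = ⊤ := eq_top_of_eigenClass_mem hω (by rw [← hmn, hc, h0, zero_smul, zero_add]; exact hn)
    rw [← hMN.inf_eq_bot, hN, inf_top_eq]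
  · right
    refine eq_top_of_eigenClass_mem hω ?_
    have := M.toSubmodule.smul_mem c⁻¹ hm
    rwa [hc, inv_smul_smul₀ h0] at this

lemma finrank_homologyIR : Module.finrank ℂ (homologyIR 3 3) = 8 :=
  exists_root.elim fun _ => finrank_homologyIR_of_root

end RegularMatroid

theorem mainTheorem4 :
    (RegularMatroid.homologyRep 3 3).IsIrreducible ∧
    Module.finrank ℂ (RegularMatroid.homologyIR 3 3) = 8 ∧
    ∀ (V : Type*) [AddCommGroup V] [Module ℂ V]
      (σ : Representation ℂ (Matrix.SpecialLinearGroup (Fin 3) (ZMod 2)) V),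
      σ.IsIrreducible → Module.finrank ℂ V = 8 →
        Nonempty (σ.Equiv (RegularMatroid.homologyRep 3 3)) := by
  refine ⟨RegularMatroid.isIrreducible_homologyRep, RegularMatroid.finrank_homologyIR,
    fun V _ _ σ hσ hV => ?_⟩
  obtain ⟨v, hv, hA, ζ, hζ, hB⟩ := RegularMatroid.exists_eigenvector (σ := σ) hV
  have hζ1 : ζ - 1 ≠ 0 := by
    intro h
    rw [sub_eq_zero.1 h, one_smul] at hB
    exact RegularMatroid.frob_eigenvalue_ne_one hσ hV hv hA hB
  -- Either primitive cube root may occur in `V`; the comparison uses the eigenclass built from this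
  -- same `ζ`.
  have hω : ζ ^ 2 + ζ + 1 = 0 :=
    (mul_eq_zero.1 (by linear_combination hζ : (ζ - 1) * (ζ ^ 2 + ζ + 1) = 0)).resolve_left hζ1
  exact RegularMatroid.nonempty_equiv_of_eigenvectors hσ hV
    RegularMatroid.isIrreducible_homologyRep RegularMatroid.finrank_homologyIR hv hA hB
    (RegularMatroid.eigenClass_ne_zero hω) (RegularMatroid.homologyRep_singer_eigenClass ζ)
    (RegularMatroid.homologyRep_frob_eigenClass hω)
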